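/- Let $a>0$ and let $\Omega\subset\mathbb R^2$ be (the interior of) an isosceles right triangle, placed anywhere in the plane, with legs of length $a$ (so of area $a^2/2$). For $\lambda\in\mathbb R$ let $E_\lambda$ be the space of real-valued $u\in H^2(\Omega)\cap H^1_0(\Omega)$ with $\Delta u+\lambda u=0$ in $\Omega$; the Dirichlet eigenvalues of $\Omega$ are the $\lambda$ with $E_\lambda\neq0$, and $m(\lambda)=\dim E_\lambda$ is the multiplicity. Every $E_\lambda$ is finite-dimensional, every Dirichlet eigenvalue is positive, and the spectral zeta function $$\zeta_\diamondsuit(s)=\sum_{\lambda} m(\lambda)\,\lambda^{-s}\qquad(\text{sum over the Dirichlet eigenvalues }\lambda\text{ of }\Omega)$$ converges absolutely for $\operatorname{Re}s>1$. For these $s$ it is equal to each of the two expressions \begin{align*} \zeta_\diamondsuit(s)={}&-\frac14\Bigl(\frac a\pi\Bigr)^{2s}\zeta_R(2s)-\frac1{2^{s+1}}\Bigl(\frac a\pi\Bigr)^{2s}\zeta_R(2s)+\frac{\sqrt\pi}4\Bigl(\frac a\pi\Bigr)^{2s}\frac{\zeta_R(2s-1)\,\Gamma(s-\frac12)}{\Gamma(s)}\\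 &+\frac12\Bigl(\frac{a^2}\pi\Bigr)^{s}\frac1{\Gamma(s)}\sum_{n=1}^\infty n^{s-1/2}\sum_{d\mid n}d^{1-2s}\int_0^\infty x^{s-3/2}e^{-\pi n(x+x^{-1})}\,dx \end{align*} and $$\zeta_\diamondsuit(s)=\frac{a^{2s}}2\left[\frac14G_\diamondsuit(s)-\frac1{\pi^{2s}}\zeta_R(2s)-\frac1{(2\pi^2)^s}\zeta_R(2s)\right],\qquad G_\diamondsuit(s)=\sum_{(m,n)\in\mathbb Z^2\setminus\{(0,0)\}}\frac1{\pi^{2s}|m+ni|^{2s}},$$ where $\zeta_R$ is the Riemann zeta function and the series $G_\diamondsuit(s)$ converges absolutely for $\operatorname{Re}s>1$. Moreover, the integrals and the series over $n$ in the first expression converge absolutely for every $s\in\mathbb C$, and the first expression is a meromorphic function of $s$ on $\mathbb C$, hence is the meromorphic continuation of $\zeta_\diamondsuit$. -/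

import Mathlib

open MeasureTheory Set
open scoped ContDiff

noncomputable section

/-- The Euclidean plane. -/
abbrev Plane : Type := EuclideanSpace ℝ (Fin 2)

/-- The real Hilbert space `L²(Ω)` with respect to Lebesgue measure. -/
abbrev L2 (Ω : Set Plane) : Type := Lp ℝ 2 (volume.restrict Ω)

/-- The classical partial derivative `∂ᵢ φ`. -/
def pderiv (i : Fin 2) (φ : Plane → ℝ) (x : Plane) : ℝ :=
  fderiv ℝ φ x (EuclideanSpace.single i 1)

/-- `φ ∈ C_c^∞(Ω)`. -/
structure IsTestFunction (Ω : Set Plane) (φ : Plane → ℝ) : Prop where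
  smooth : ContDiff ℝ ∞ φ
  compact : HasCompactSupport φ
  support : tsupport φ ⊆ Ω

/-- `g` is the weak partial derivative `∂ᵢ u` on `Ω`. -/
def IsWeakDeriv (Ω : Set Plane) (i : Fin 2) (u g : L2 Ω) : Prop :=
  ∀ φ : Plane → ℝ, IsTestFunction Ω φ →
    ∫ x in Ω, u x * pderiv i φ x = - ∫ x in Ω, g x * φ x

theorem pderiv_add {i : Fin 2} {φ ψ : Plane → ℝ} (hφ : ContDiff ℝ ∞ φ) (hψ : ContDiff ℝ ∞ ψ) :
    pderiv i (φ + ψ) = pderiv i φ + pderiv i ψ := by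
  funext x
  simp only [pderiv, Pi.add_apply]
  rw [fderiv_add ((hφ.differentiable (by simp)) x) ((hψ.differentiable (by simp)) x)]
  rfl

theorem pderiv_smul {i : Fin 2} (c : ℝ) {φ : Plane → ℝ} (hφ : ContDiff ℝ ∞ φ) :
    pderiv i (c • φ) = c • pderiv i φ := by
  funext x
  simp only [pderiv, Pi.smul_apply]
  rw [fderiv_const_smul ((hφ.differentiable (by simp)) x)]
  rfl

namespace IsTestFunction

variable {Ω : Set Plane} {φ ψ : Plane → ℝ}

theorem zero (Ω : Set Plane) : IsTestFunction Ω (0 : Plane → ℝ) :=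
  ⟨contDiff_const, HasCompactSupport.zero, by simp [tsupport]⟩

theorem add (hφ : IsTestFunction Ω φ) (hψ : IsTestFunction Ω ψ) : IsTestFunction Ω (φ + ψ) :=
  ⟨hφ.smooth.add hψ.smooth, hφ.compact.add hψ.compact,
    (tsupport_add φ ψ).trans (union_subset hφ.support hψ.support)⟩

theorem smul (c : ℝ) (hφ : IsTestFunction Ω φ) : IsTestFunction Ω (c • φ) :=
  ⟨hφ.smooth.const_smul c, hφ.compact.smul_left (f := fun _ => c),
    (closure_mono (Function.support_const_smul_subset c φ)).trans hφ.support⟩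

theorem memLp (hφ : IsTestFunction Ω φ) : MemLp φ 2 (volume.restrict Ω) :=
  (hφ.smooth.continuous.memLp_of_hasCompactSupport hφ.compact).restrict Ω

theorem memLp_pderiv (hφ : IsTestFunction Ω φ) (i : Fin 2) :
    MemLp (pderiv i φ) 2 (volume.restrict Ω) := by
  have h1 : Continuous (pderiv i φ) :=
    (hφ.smooth.continuous_fderiv (by simp)).clm_apply continuous_const
  have h2 : HasCompactSupport (pderiv i φ) := hφ.compact.fderiv_apply ℝ _
  exact (h1.memLp_of_hasCompactSupport h2).restrict Ω

end IsTestFunction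

theorem IsWeakDeriv.zero (Ω : Set Plane) (i : Fin 2) : IsWeakDeriv Ω i 0 0 := by
  intro φ _
  have h : ∀ f : Plane → ℝ, ∫ x in Ω, (0 : L2 Ω) x * f x = 0 := fun f =>
    integral_eq_zero_of_ae (by
      filter_upwards [Lp.coeFn_zero ℝ 2 (volume.restrict Ω)] with x hx
      rw [hx, Pi.zero_apply, zero_mul])
  rw [h, h, neg_zero]

theorem integral_Lp_add_mul {Ω : Set Plane} (u v : L2 Ω) {f : Plane → ℝ}
    (hf : MemLp f 2 (volume.restrict Ω)) :
    ∫ x in Ω, (u + v) x * f x = (∫ x in Ω, u x * f x) + ∫ x in Ω, v x * f x := by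
  refine Eq.trans (integral_congr_ae ?_)
    (integral_add ((Lp.memLp u).integrable_mul hf) ((Lp.memLp v).integrable_mul hf))
  filter_upwards [Lp.coeFn_add u v] with x hx
  rw [hx, Pi.add_apply, add_mul]

theorem integral_Lp_smul_mul {Ω : Set Plane} (c : ℝ) (u : L2 Ω) (f : Plane → ℝ) :
    ∫ x in Ω, (c • u) x * f x = c * ∫ x in Ω, u x * f x := by
  rw [← integral_const_mul]
  refine integral_congr_ae ?_
  filter_upwards [Lp.coeFn_smul c u] with x hx
  simp [hx, mul_assoc]

theorem IsWeakDeriv.add {Ω : Set Plane} {i : Fin 2} {u v g k : L2 Ω}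
    (hu : IsWeakDeriv Ω i u g) (hv : IsWeakDeriv Ω i v k) : IsWeakDeriv Ω i (u + v) (g + k) := by
  intro φ hφ
  rw [integral_Lp_add_mul _ _ (hφ.memLp_pderiv i), integral_Lp_add_mul _ _ hφ.memLp,
    hu φ hφ, hv φ hφ]
  ring

theorem IsWeakDeriv.smul {Ω : Set Plane} {i : Fin 2} (c : ℝ) {u g : L2 Ω}
    (hu : IsWeakDeriv Ω i u g) : IsWeakDeriv Ω i (c • u) (c • g) := by
  intro φ hφ
  rw [integral_Lp_smul_mul, integral_Lp_smul_mul, hu φ hφ]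
  ring

/-- The pairs `(φ, ∇φ)` with `φ ∈ C_c^∞(Ω)`, inside `L²(Ω) × L²(Ω)²`. -/
def testGraph (Ω : Set Plane) : Submodule ℝ (L2 Ω × (Fin 2 → L2 Ω)) where
  carrier := {p | ∃ φ : Plane → ℝ, IsTestFunction Ω φ ∧ p.1 =ᵐ[volume.restrict Ω] φ ∧
    ∀ i, p.2 i =ᵐ[volume.restrict Ω] pderiv i φ}
  zero_mem' := by
    refine ⟨0, IsTestFunction.zero Ω, Lp.coeFn_zero ℝ 2 _, fun i => ?_⟩
    have h : pderiv i (0 : Plane → ℝ) = 0 := by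
      funext x
      simp [pderiv]
    rw [h]
    exact Lp.coeFn_zero ℝ 2 _
  add_mem' := by
    rintro p q ⟨φ, hφ, h1, h2⟩ ⟨ψ, hψ, k1, k2⟩
    refine ⟨φ + ψ, hφ.add hψ, (Lp.coeFn_add _ _).trans (h1.add k1), fun i => ?_⟩
    rw [pderiv_add hφ.smooth hψ.smooth]
    exact (Lp.coeFn_add _ _).trans ((h2 i).add (k2 i))
  smul_mem' := by
    rintro c p ⟨φ, hφ, h1, h2⟩
    refine ⟨c • φ, hφ.smul c, (Lp.coeFn_smul _ _).trans (h1.const_smul c), fun i => ?_⟩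
    rw [pderiv_smul c hφ.smooth]
    exact (Lp.coeFn_smul _ _).trans ((h2 i).const_smul c)

/-- The Sobolev space `H₀¹(Ω)`: the closure of `C_c^∞(Ω)` in the `H¹`-norm
(the set of first components of the closure of `{(φ, ∇φ)}` in `L²`). -/
def sobolevH10 (Ω : Set Plane) : Submodule ℝ (L2 Ω) :=
  (testGraph Ω).topologicalClosure.map (LinearMap.fst ℝ (L2 Ω) (Fin 2 → L2 Ω))

/-- The space of solutions `u ∈ H²(Ω) ∩ H₀¹(Ω)` of `Δu + lam u = 0` in `Ω`. Here `g i = ∂ᵢ u` and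
`h i j = ∂ⱼ ∂ᵢ u` are the weak derivatives of `u`; membership in `H₀¹(Ω)` is the Dirichlet boundary
condition. -/
def dirichletEigenspace (Ω : Set Plane) (lam : ℝ) : Submodule ℝ (L2 Ω) where
  carrier := {u | u ∈ sobolevH10 Ω ∧ ∃ (g : Fin 2 → L2 Ω) (h : Fin 2 → Fin 2 → L2 Ω),
    (∀ i, IsWeakDeriv Ω i u (g i)) ∧ (∀ i j, IsWeakDeriv Ω j (g i) (h i j)) ∧
    ∑ i, h i i + lam • u = 0}
  zero_mem' := ⟨Submodule.zero_mem _, 0, 0, fun i => IsWeakDeriv.zero Ω i,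
    fun _ j => IsWeakDeriv.zero Ω j, by simp⟩
  add_mem' := by
    rintro u v ⟨hu, g, h, h1, h2, h3⟩ ⟨hv, g', h', k1, k2, k3⟩
    refine ⟨Submodule.add_mem _ hu hv, g + g', h + h', fun i => (h1 i).add (k1 i),
      fun i j => (h2 i j).add (k2 i j), ?_⟩
    have : ∑ i, (h + h') i i + lam • (u + v)
        = (∑ i, h i i + lam • u) + (∑ i, h' i i + lam • v) := by
      simp only [Pi.add_apply, Finset.sum_add_distrib, smul_add]
      abel
    rw [this, h3, k3, add_zero]
  smul_mem' := by
    rintro c u ⟨hu, g, h, h1, h2, h3⟩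
    refine ⟨Submodule.smul_mem _ c hu, c • g, c • h, fun i => (h1 i).smul c,
      fun i j => (h2 i j).smul c, ?_⟩
    have : ∑ i, (c • h) i i + lam • (c • u) = c • (∑ i, h i i + lam • u) := by
      simp only [Pi.smul_apply, smul_add, Finset.smul_sum, smul_comm lam c u]
    rw [this, h3, smul_zero]

/-- The Dirichlet eigenvalues of `Ω`. -/
def dirichletSpectrum (Ω : Set Plane) : Set ℝ := {lam | dirichletEigenspace Ω lam ≠ ⊥}

/-- The term `m(lam) * lam ^ (-s)` of the spectral zeta function, where `m(lam)` is the
multiplicity of `lam`. -/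
def spectralZetaTerm (Ω : Set Plane) (s : ℂ) (lam : dirichletSpectrum Ω) : ℂ :=
  (Module.finrank ℝ (dirichletEigenspace Ω lam) : ℂ) * ((lam : ℝ) : ℂ) ^ (-s)

/-- The spectral zeta function: the sum of `lam ^ (-s)` over the Dirichlet eigenvalues of `Ω`,
counted with multiplicity. -/
def dirichletSpectralZeta (Ω : Set Plane) (s : ℂ) : ℂ :=
  ∑' lam : dirichletSpectrum Ω, spectralZetaTerm Ω s lam

/-- The open triangle with vertices `P`, `Q`, `R`. -/
def openTriangle (P Q R : Plane) : Set Plane :=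
  {x | ∃ p q : ℝ, 0 < p ∧ 0 < q ∧ p + q < 1 ∧ x = P + p • (Q - P) + q • (R - P)}

/-- `Ω` is (the interior of) an isosceles right triangle whose legs, which meet at `P`,
have length `a`. -/
def IsIsoscelesRightTriangle (a : ℝ) (Ω : Set Plane) : Prop :=
  ∃ P Q R : Plane, dist P Q = a ∧ dist P R = a ∧ inner ℝ (Q - P) (R - P) = 0 ∧
    Ω = openTriangle P Q R

/-- The term `1 / (π^(2s) |m + n i|^(2s))` of the Epstein zeta function of the square lattice. -/
def latticeTerm (s : ℂ) (p : ℤ × ℤ) : ℂ :=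
  1 / ((Real.pi : ℂ) ^ (2 * s) * ((‖(p.1 : ℂ) + (p.2 : ℂ) * Complex.I‖ : ℝ) : ℂ) ^ (2 * s))

/-- The Epstein zeta function of the square lattice; the sum is over `(m, n) ≠ (0, 0)`. -/
def latticeG (s : ℂ) : ℂ := ∑' p : {p : ℤ × ℤ // p ≠ 0}, latticeTerm s p

/-- The integrand `x^(s - 3/2) * exp (-π n (x + 1/x))`. -/
def besselIntegrand (s : ℂ) (n : ℕ+) (x : ℝ) : ℂ :=
  (x : ℂ) ^ (s - 3 / 2) * (Real.exp (-Real.pi * (n : ℕ) * (x + x⁻¹)) : ℂ)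

/-- The `n`-th term of the divisor-sum series. -/
def divisorTerm (s : ℂ) (n : ℕ+) : ℂ :=
  ((n : ℕ) : ℂ) ^ (s - 1 / 2) * (∑ d ∈ (n : ℕ).divisors, (d : ℂ) ^ (1 - 2 * s)) *
    ∫ x in Ioi (0 : ℝ), besselIntegrand s n x

/-- The Chowla–Selberg type expression. -/
def chowlaSelbergExpr (a : ℝ) (s : ℂ) : ℂ :=
  -(1 / 4) * ((a / Real.pi : ℝ) : ℂ) ^ (2 * s) * riemannZeta (2 * s)
    - 1 / (2 : ℂ) ^ (s + 1) * ((a / Real.pi : ℝ) : ℂ) ^ (2 * s) * riemannZeta (2 * s)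
    + (Real.sqrt Real.pi : ℂ) / 4 * ((a / Real.pi : ℝ) : ℂ) ^ (2 * s) *
        (riemannZeta (2 * s - 1) * Complex.Gamma (s - 1 / 2) / Complex.Gamma s)
    + 1 / 2 * ((a ^ 2 / Real.pi : ℝ) : ℂ) ^ s * (1 / Complex.Gamma s) *
        ∑' n : ℕ+, divisorTerm s n

end

/-! An affine chart with orthogonal gradients of squared length `κ = (π/a)²` carries the triangle to
`0 < Y < X < π`. There the antisymmetrized products `sin(mX) sin(nY) - sin(nX) sin(mY)` vanish on
all three sides and satisfy `Δu = -κ(m² + n²)u`. The point is that the modes with `m > n ≥ 1` give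
the whole Dirichlet spectrum, with multiplicity.

Each mode is bounded by a constant times the distance function of each side, so cutting it off near
the boundary keeps gradients bounded and puts it in `H₀¹` (`mem_closure_of_abs_le_mul`). Green's
formula then makes an eigenfunction orthogonal to every mode with a different eigenvalue.
Completeness comes from Stone–Weierstrass, applied to the multipliers of the span of the modes
rather than to the modes themselves (`exists_multiplier_near`), together with one mode that has no
zero in the triangle. Hence each eigenspace is spanned by its modes (`dirichletEigenspace_eq`), and
these are independent. So the zeta function is `κ^(-s)` times the sum `T(s)` of `(m² + n²)^(-s)`
over `m > n ≥ 1`.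

The symmetries of the square lattice express `T` through the Epstein zeta function and `ζ(2s)`. For
the other formula, let `ω(t) = ∑_{n ≥ 1} exp(-πn²t)`. The quadrant sum is, up to `π^(-s) Γ(s)`, the
Mellin transform of `ω²`. Jacobi inversion applied to only one of the two factors leaves two zeta
terms and the Mellin transform of `ω(t) ω(1/t)`, whose terms, collected by the product `N = mn`, are
Bessel integrals weighted by divisor sums (`hasSum_divisorTerm`). These integrals decay like
`exp(-πN)` uniformly on vertical strips, so their series is entire, and the whole expression is
meromorphic. -/

/-! ### Weak derivatives, `H₀¹` and Green's formula. -/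

section SmoothFunctions

open Filter Topology

variable {Ω : Set Plane} {U V : Plane → ℝ}

theorem contDiff_pderiv (hU : ContDiff ℝ ∞ U) (i : Fin 2) : ContDiff ℝ ∞ (pderiv i U) :=
  (hU.fderiv_right (m := ∞) (by simp)).clm_apply contDiff_const

theorem Continuous.exists_bound_of_isBounded (hb : Bornology.IsBounded Ω) (hU : Continuous U) :
    ∃ C, ∀ x ∈ Ω, ‖U x‖ ≤ C := by
  obtain ⟨C, hC⟩ := hb.isCompact_closure.exists_bound_of_continuousOn hU.continuousOn
  exact ⟨C, fun x hx => hC x (subset_closure hx)⟩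

theorem isFiniteMeasure_restrict_of_isBounded (hb : Bornology.IsBounded Ω) :
    IsFiniteMeasure (volume.restrict Ω) :=
  isFiniteMeasure_restrict.2 hb.measure_lt_top.ne

theorem Continuous.memLp_two_of_isBounded (ho : IsOpen Ω) (hb : Bornology.IsBounded Ω)
    (hU : Continuous U) : MemLp U 2 (volume.restrict Ω) := by
  obtain ⟨C, hC⟩ := hU.exists_bound_of_isBounded hb
  have := isFiniteMeasure_restrict_of_isBounded hb
  exact MemLp.of_bound hU.aestronglyMeasurable C
    ((ae_restrict_iff' ho.measurableSet).2 (.of_forall hC))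

theorem pderiv_mul (hU : ContDiff ℝ ∞ U) (hV : ContDiff ℝ ∞ V) (i : Fin 2) (x : Plane) :
    pderiv i (fun y => U y * V y) x = pderiv i U x * V x + U x * pderiv i V x := by
  simp only [pderiv]
  rw [fderiv_fun_mul ((hU.differentiable (by simp)) x) ((hV.differentiable (by simp)) x)]
  simp
  ring

/-- No boundary term and no regularity of `Ω` enter: `φ` is supported inside `Ω`, so both integrals
extend to the whole plane. -/
theorem integral_mul_pderiv (hU : ContDiff ℝ ∞ U) {φ : Plane → ℝ} (hφ : IsTestFunction Ω φ)
    (i : Fin 2) :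
    ∫ x in Ω, U x * pderiv i φ x = - ∫ x in Ω, pderiv i U x * φ x := by
  have h0 : Function.support (pderiv i φ) ⊆ tsupport φ := by
    refine (subset_tsupport _).trans ?_
    exact (tsupport_fderiv_apply_subset ℝ _)
  have hs1 : Function.support (fun x => U x * pderiv i φ x) ⊆ Ω :=
    (Function.support_mul_subset_right _ _).trans (h0.trans hφ.support)
  have hs2 : Function.support (fun x => pderiv i U x * φ x) ⊆ Ω :=
    (Function.support_mul_subset_right _ _).trans ((subset_tsupport _).trans hφ.support)
  rw [setIntegral_eq_integral_of_forall_compl_eq_zero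
      (fun x hx => Function.notMem_support.1 fun h => hx (hs1 h)),
    setIntegral_eq_integral_of_forall_compl_eq_zero
      (fun x hx => Function.notMem_support.1 fun h => hx (hs2 h))]
  have hc : HasCompactSupport (pderiv i φ) := hφ.compact.fderiv_apply ℝ _
  refine integral_mul_fderiv_eq_neg_fderiv_mul_of_integrable ?_ ?_ ?_ ?_ ?_
  · exact ((contDiff_pderiv hU i).continuous.mul hφ.smooth.continuous).integrable_of_hasCompactSupport
      hφ.compact.mul_left
  · exact (hU.continuous.mul
      (contDiff_pderiv hφ.smooth i).continuous).integrable_of_hasCompactSupport hc.mul_left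
  · exact (hU.continuous.mul hφ.smooth.continuous).integrable_of_hasCompactSupport
      hφ.compact.mul_left
  · exact fun x _ => hU.differentiable (by simp) x
  · exact fun x _ => hφ.smooth.differentiable (by simp) x

theorem isWeakDeriv_of_contDiff (hU : ContDiff ℝ ∞ U) {i : Fin 2} {u g : L2 Ω}
    (hu : u =ᵐ[volume.restrict Ω] U) (hg : g =ᵐ[volume.restrict Ω] pderiv i U) :
    IsWeakDeriv Ω i u g := by
  intro φ hφ
  refine (integral_congr_ae (hu.mul (ae_eq_refl (pderiv i φ)))).trans
    ((integral_mul_pderiv hU hφ i).trans (congrArg Neg.neg (integral_congr_ae ?_)))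
  exact hg.symm.mul (ae_eq_refl φ)

theorem inner_eq_integral_of_ae_eq {u v : L2 Ω} {V : Plane → ℝ}
    (hv : v =ᵐ[volume.restrict Ω] V) : inner ℝ u v = ∫ x in Ω, u x * V x := by
  rw [L2.inner_def]
  refine integral_congr_ae ?_
  filter_upwards [hv] with x hx
  simp [hx, mul_comm]

theorem IsWeakDeriv.inner_eq_neg {i : Fin 2} {u g w k : L2 Ω} (h : IsWeakDeriv Ω i u g)
    {φ : Plane → ℝ} (hφ : IsTestFunction Ω φ) (hw : w =ᵐ[volume.restrict Ω] φ)
    (hk : k =ᵐ[volume.restrict Ω] pderiv i φ) : inner ℝ u k = - inner ℝ g w := by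
  rw [inner_eq_integral_of_ae_eq hk, inner_eq_integral_of_ae_eq hw, h φ hφ]

/-- Integration by parts for a pair in the `H¹`-closure of the test functions. -/
theorem IsWeakDeriv.inner_closure {i : Fin 2} {u g : L2 Ω} (h : IsWeakDeriv Ω i u g)
    {p : L2 Ω × (Fin 2 → L2 Ω)} (hp : p ∈ (testGraph Ω).topologicalClosure) :
    inner ℝ u (p.2 i) = - inner ℝ g p.1 := by
  have hcl : IsClosed {p : L2 Ω × (Fin 2 → L2 Ω) | inner ℝ u (p.2 i) = - inner ℝ g p.1} :=
    isClosed_eq (by fun_prop) (by fun_prop)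
  refine closure_minimal ?_ hcl hp
  rintro q ⟨φ, hφ, h1, h2⟩
  exact h.inner_eq_neg hφ h1 (h2 i)

/-- Test functions are themselves weakly differentiable, so `IsWeakDeriv.inner_closure` can be used
with the roles exchanged: `φ` is the weakly differentiable factor and `p` the limit of test
functions. -/
theorem isWeakDeriv_of_mem_closure {p : L2 Ω × (Fin 2 → L2 Ω)}
    (hp : p ∈ (testGraph Ω).topologicalClosure) (i : Fin 2) : IsWeakDeriv Ω i p.1 (p.2 i) := by
  intro φ hφ
  have hm := hφ.memLp
  have hm' := hφ.memLp_pderiv i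
  have hw : IsWeakDeriv Ω i (hm.toLp φ) (hm'.toLp _) :=
    isWeakDeriv_of_contDiff hφ.smooth hm.coeFn_toLp hm'.coeFn_toLp
  have := hw.inner_closure hp
  rw [← inner_eq_integral_of_ae_eq hm'.coeFn_toLp, ← inner_eq_integral_of_ae_eq hm.coeFn_toLp,
    real_inner_comm, real_inner_comm (hm.toLp φ), this, neg_neg]

theorem ae_eq_zero_of_integral_testFunction {f : Plane → ℝ} (ho : IsOpen Ω)
    (hf : LocallyIntegrableOn f Ω) (h : ∀ φ, IsTestFunction Ω φ → ∫ x in Ω, f x * φ x = 0) :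
    f =ᵐ[volume.restrict Ω] 0 := by
  refine (ae_restrict_iff' ho.measurableSet).2 ?_
  refine ho.ae_eq_zero_of_integral_contDiff_smul_eq_zero hf fun φ h1 h2 h3 => ?_
  rw [← h φ ⟨h1, h2, h3⟩, setIntegral_eq_integral_of_forall_compl_eq_zero]
  · simp [mul_comm]
  · intro x hx
    rw [image_eq_zero_of_notMem_tsupport fun h => hx (h3 h), mul_zero]

theorem integrableOn_Lp_two (hb : Bornology.IsBounded Ω) (u : L2 Ω) : IntegrableOn u Ω := by
  have := isFiniteMeasure_restrict_of_isBounded hb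
  exact (Lp.memLp u).integrable (by norm_num)

theorem IsWeakDeriv.unique (ho : IsOpen Ω) (hb : Bornology.IsBounded Ω) {i : Fin 2}
    {u g g' : L2 Ω} (h : IsWeakDeriv Ω i u g) (h' : IsWeakDeriv Ω i u g') : g = g' := by
  rw [← sub_eq_zero]
  refine Lp.ext ?_
  refine (ae_eq_zero_of_integral_testFunction ho
    (integrableOn_Lp_two hb _).locallyIntegrableOn fun φ hφ => ?_).trans (Lp.coeFn_zero ..).symm
  have h3 := h φ hφ
  rw [h' φ hφ, neg_inj] at h3
  have := integral_Lp_add_mul g ((-1 : ℝ) • g') hφ.memLp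
  rw [integral_Lp_smul_mul, h3] at this
  rw [sub_eq_add_neg, ← neg_one_smul ℝ g', this]
  ring

/-- Green's formula: a Dirichlet eigenfunction is orthogonal to every `v ∈ H₀¹(Ω)` with smooth
representative `V` satisfying `ΔV = -μ V` for another `μ`. -/
theorem inner_eq_zero_of_mem_dirichletEigenspace (ho : IsOpen Ω) (hb : Bornology.IsBounded Ω)
    {lam μ : ℝ} {u : L2 Ω} (hu : u ∈ dirichletEigenspace Ω lam)
    {p : L2 Ω × (Fin 2 → L2 Ω)} (hp : p ∈ (testGraph Ω).topologicalClosure)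
    {k : Fin 2 → L2 Ω} (hk : ∀ i, IsWeakDeriv Ω i (p.2 i) (k i))
    (hΔ : ∑ i, k i + μ • p.1 = 0) (hne : μ ≠ lam) : inner ℝ u p.1 = 0 := by
  obtain ⟨⟨q, hq, rfl⟩, g, h, h1, h2, h3⟩ := hu
  simp only [LinearMap.fst_apply] at *
  -- Two gradients of `u` are in play: the limit of the gradients of the approximating test
  -- functions, and the one in the equation. Uniqueness of weak derivatives identifies them.
  have hg : ∀ i, q.2 i = g i := fun i =>
    (isWeakDeriv_of_mem_closure hq i).unique ho hb (h1 i)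
  have e1 : ∀ i, inner ℝ (g i) (p.2 i) = - inner ℝ (h i i) p.1 := fun i =>
    (h2 i i).inner_closure hp
  have e2 : ∀ i, inner ℝ (p.2 i) (g i) = - inner ℝ (k i) q.1 := fun i => by
    rw [← hg i]; exact (hk i).inner_closure hq
  have e3 : inner ℝ (∑ i, h i i + lam • q.1) p.1 = 0 := by rw [h3, inner_zero_left]
  have e4 : inner ℝ (∑ i, k i + μ • p.1) q.1 = 0 := by rw [hΔ, inner_zero_left]
  simp only [inner_add_left, sum_inner, real_inner_smul_left] at e3 e4
  -- Both sides equal minus the Dirichlet form of the two functions, which is symmetric.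
  have e5 : ∑ i, inner ℝ (h i i) p.1 = ∑ i, inner ℝ (k i) q.1 :=
    Finset.sum_congr rfl fun i _ => by
      rw [← neg_inj, ← e1, ← e2, real_inner_comm]
  rw [e5] at e3
  rw [real_inner_comm] at e4
  have : (μ - lam) * inner ℝ q.1 p.1 = 0 := by linear_combination e4 - e3
  exact (mul_eq_zero.1 this).resolve_left (sub_ne_zero.2 hne)

/-- A pointwise bounded, pointwise convergent sequence of test functions with its gradients
converges in `H¹`. -/
theorem mem_topologicalClosure_testGraph (ho : IsOpen Ω) (hb : Bornology.IsBounded Ω)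
    {p : L2 Ω × (Fin 2 → L2 Ω)} (hU : ContDiff ℝ ∞ U)
    (hp1 : p.1 =ᵐ[volume.restrict Ω] U) (hp2 : ∀ i, p.2 i =ᵐ[volume.restrict Ω] pderiv i U)
    {ψ : ℕ → Plane → ℝ} (hψ : ∀ n, IsTestFunction Ω (ψ n)) {C : ℝ}
    (h1 : ∀ n, ∀ x ∈ Ω, |ψ n x| ≤ C) (h2 : ∀ i n, ∀ x ∈ Ω, |pderiv i (ψ n) x| ≤ C)
    (h3 : ∀ x ∈ Ω, Tendsto (fun n => ψ n x) atTop (𝓝 (U x)))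
    (h4 : ∀ i, ∀ x ∈ Ω, Tendsto (fun n => pderiv i (ψ n) x) atTop (𝓝 (pderiv i U x))) :
    p ∈ (testGraph Ω).topologicalClosure := by
  have := isFiniteMeasure_restrict_of_isBounded hb
  have key : ∀ {f : ℕ → Plane → ℝ} {F : Plane → ℝ} (hf : ∀ n, MemLp (f n) 2 (volume.restrict Ω))
      (hF : MemLp F 2 (volume.restrict Ω)), (∀ n, ∀ x ∈ Ω, |f n x| ≤ C) →
      (∀ x ∈ Ω, Tendsto (fun n => f n x) atTop (𝓝 (F x))) →
      Tendsto (fun n => (hf n).toLp (f n)) atTop (𝓝 (hF.toLp F)) := by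
    intro f F hf hF hC ht
    rw [Lp.tendsto_Lp_iff_tendsto_eLpNorm'']
    refine tendsto_Lp_finite_of_tendsto_ae (by norm_num) (by norm_num) (fun n => (hf n).1) hF ?_
      ((ae_restrict_iff' ho.measurableSet).2 (.of_forall ht))
    -- At the truncation level `C + 1` nothing is left of the uniformly bounded `f n`, so the tails
    -- vanish on `Ω`.
    refine unifIntegrable_of (by norm_num) (by norm_num) (fun n => (hf n).1) fun ε hε =>
      ⟨(C + 1).toNNReal, fun n => ?_⟩
    refine (eLpNorm_congr_ae ?_).trans_le ((eLpNorm_zero (p := 2)).trans_le zero_le)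
    refine (ae_restrict_iff' ho.measurableSet).2 (.of_forall fun x hx => ?_)
    refine indicator_of_notMem (fun h => ?_) _
    simp only [mem_ofPred_eq, ← NNReal.coe_le_coe, coe_nnnorm, Real.norm_eq_abs] at h
    have := (Real.le_coe_toNNReal _).trans h
    linarith [hC n x hx]
  have hm := hU.continuous.memLp_two_of_isBounded ho hb
  have hm' := fun i => (contDiff_pderiv hU i).continuous.memLp_two_of_isBounded ho hb
  have hpe : p = (hm.toLp U, fun i => (hm' i).toLp (pderiv i U)) :=
    Prod.ext (Lp.ext (hp1.trans hm.coeFn_toLp.symm))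
      (funext fun i => Lp.ext ((hp2 i).trans (hm' i).coeFn_toLp.symm))
  rw [hpe]
  have ht : Tendsto (fun n => (((hψ n).memLp.toLp (ψ n),
      fun i => ((hψ n).memLp_pderiv i).toLp _) : L2 Ω × (Fin 2 → L2 Ω))) atTop
      (𝓝 (hm.toLp U, fun i => (hm' i).toLp (pderiv i U))) :=
    (key _ _ h1 h3).prodMk_nhds (tendsto_pi_nhds.2 fun i => key _ _ (h2 i) (h4 i))
  exact mem_closure_of_tendsto ht
    (.of_forall fun n => ⟨ψ n, hψ n, (hψ n).memLp.coeFn_toLp, fun i => ((hψ n).memLp_pderiv i).coeFn_toLp⟩)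

end SmoothFunctions

/-! ### Cutting off near the boundary. -/

section Cutoff

open Filter Topology

/-- A smooth function vanishing on `(-∞, 1]` and equal to one on `[2, ∞)`. -/
noncomputable def cutoff (t : ℝ) : ℝ := Real.smoothTransition (t - 1)

theorem contDiff_cutoff : ContDiff ℝ ∞ cutoff :=
  Real.smoothTransition.contDiff.comp (contDiff_id.sub contDiff_const)

theorem cutoff_of_le {t : ℝ} (h : t ≤ 1) : cutoff t = 0 :=
  Real.smoothTransition.zero_of_nonpos (by linarith)

theorem cutoff_of_ge {t : ℝ} (h : 2 ≤ t) : cutoff t = 1 :=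
  Real.smoothTransition.one_of_one_le (by linarith)

theorem abs_cutoff_le (t : ℝ) : |cutoff t| ≤ 1 := by
  rw [cutoff, abs_of_nonneg (Real.smoothTransition.nonneg _)]
  exact Real.smoothTransition.le_one _

/-- The derivative of the cutoff lives on `[1, 2]`. The weight `t` is what makes the bound
independent of scale: it controls `l` times the derivative of `cutoff (k * l)` for all `k` at once.
-/
theorem exists_bound_mul_deriv_cutoff : ∃ B, 0 ≤ B ∧ ∀ t, |t * deriv cutoff t| ≤ B := by
  have hc : Continuous fun t => t * deriv cutoff t :=
    continuous_id.mul (contDiff_cutoff.continuous_deriv (by simp))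
  obtain ⟨B, hB⟩ := (isCompact_Icc (a := (1 : ℝ)) (b := 2)).exists_bound_of_continuousOn
    hc.continuousOn
  have hB0 : 0 ≤ B := (norm_nonneg _).trans (hB 1 (by norm_num))
  refine ⟨B, hB0, fun t => ?_⟩
  by_cases h1 : t < 1
  · have : cutoff =ᶠ[𝓝 t] fun _ => 0 := by
      filter_upwards [Iio_mem_nhds h1] with y hy using cutoff_of_le (le_of_lt hy)
    rw [this.deriv_eq]
    simpa
  by_cases h2 : 2 < t
  · have : cutoff =ᶠ[𝓝 t] fun _ => 1 := by
      filter_upwards [Ioi_mem_nhds h2] with y hy using cutoff_of_ge (le_of_lt hy)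
    rw [this.deriv_eq]
    simpa
  exact hB t ⟨not_lt.1 h1, not_lt.1 h2⟩

theorem pderiv_comp_smul {f : ℝ → ℝ} (hf : ContDiff ℝ ∞ f) {l : Plane → ℝ} (hl : ContDiff ℝ ∞ l)
    (k : ℝ) (i : Fin 2) (x : Plane) :
    pderiv i (fun y => f (k * l y)) x = k * deriv f (k * l x) * pderiv i l x := by
  have h1 : HasFDerivAt (fun y => k * l y) (k • fderiv ℝ l x) x :=
    ((hl.differentiable (by simp)) x).hasFDerivAt.const_mul k
  have h2 : HasDerivAt f (deriv f (k * l x)) (k * l x) :=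
    ((hf.differentiable (by simp)) _).hasDerivAt
  have := (h2.comp_hasFDerivAt x h1).fderiv
  simp only [pderiv]
  rw [show (fun y => f (k * l y)) = f ∘ fun y => k * l y from rfl, this]
  simp
  ring

variable {Ω : Set Plane} {U : Plane → ℝ}

/-- On a bounded domain `{l₁, l₂, l₃ > 0}`, a smooth function which is `O(lᵢ)` for all `i` lies in
`H₀¹`. -/
theorem mem_closure_of_abs_le_mul (hb : Bornology.IsBounded Ω) {l₁ l₂ l₃ : Plane → ℝ}
    (h₁ : ContDiff ℝ ∞ l₁) (h₂ : ContDiff ℝ ∞ l₂) (h₃ : ContDiff ℝ ∞ l₃)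
    (hΩ : Ω = {x | 0 < l₁ x ∧ 0 < l₂ x ∧ 0 < l₃ x})
    {L : ℝ} (hL₁ : ∀ i x, |pderiv i l₁ x| ≤ L) (hL₂ : ∀ i x, |pderiv i l₂ x| ≤ L)
    (hL₃ : ∀ i x, |pderiv i l₃ x| ≤ L) (hU : ContDiff ℝ ∞ U)
    {C : ℝ} (hC₁ : ∀ x ∈ Ω, |U x| ≤ C * l₁ x) (hC₂ : ∀ x ∈ Ω, |U x| ≤ C * l₂ x)
    (hC₃ : ∀ x ∈ Ω, |U x| ≤ C * l₃ x)
    {p : L2 Ω × (Fin 2 → L2 Ω)} (hp1 : p.1 =ᵐ[volume.restrict Ω] U)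
    (hp2 : ∀ i, p.2 i =ᵐ[volume.restrict Ω] pderiv i U) :
    p ∈ (testGraph Ω).topologicalClosure := by
  have ho : IsOpen Ω := by
    rw [hΩ]
    exact (isOpen_lt continuous_const h₁.continuous).inter
      ((isOpen_lt continuous_const h₂.continuous).inter (isOpen_lt continuous_const h₃.continuous))
  have hsm : ∀ {l : Plane → ℝ}, ContDiff ℝ ∞ l → ∀ k : ℝ,
      ContDiff ℝ ∞ fun x => cutoff (k * l x) := fun hl k =>
    contDiff_cutoff.comp (contDiff_const.mul hl)
  obtain ⟨B, hB0, hB⟩ := exists_bound_mul_deriv_cutoff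
  obtain ⟨M₀, hM₀⟩ := hU.continuous.exists_bound_of_isBounded hb
  have hMi : ∀ i, ∃ M, ∀ x ∈ Ω, ‖pderiv i U x‖ ≤ M := fun i =>
    (contDiff_pderiv hU i).continuous.exists_bound_of_isBounded hb
  choose M hM using hMi
  -- The cutoff vanishes where some `lᵢ ≤ 1/(n+1)` and equals one near any given point of `Ω` once
  -- `n` is large.
  let θ : ℕ → Plane → ℝ := fun n x =>
    cutoff ((n + 1 : ℝ) * l₁ x) * (cutoff ((n + 1 : ℝ) * l₂ x) * cutoff ((n + 1 : ℝ) * l₃ x))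
  have hθ : ∀ n, ContDiff ℝ ∞ (θ n) := fun n =>
    (hsm h₁ _).mul ((hsm h₂ _).mul (hsm h₃ _))
  have hθ1 : ∀ n x, |θ n x| ≤ 1 := fun n x => by
    simp only [θ, abs_mul]
    exact mul_le_one₀ (abs_cutoff_le _) (by positivity)
      (mul_le_one₀ (abs_cutoff_le _) (by positivity) (abs_cutoff_le _))
  have hev : ∀ x ∈ Ω, ∀ᶠ n : ℕ in atTop, (fun y => θ n y * U y) =ᶠ[𝓝 x] U := by
    intro x hx
    have hl : ∀ {l : Plane → ℝ}, ContDiff ℝ ∞ l → 0 < l x →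
        ∀ᶠ n : ℕ in atTop, ∀ᶠ y in 𝓝 x, cutoff ((n + 1 : ℝ) * l y) = 1 := by
      intro l hl h0
      have : Tendsto (fun n : ℕ => ((n : ℝ) + 1) * l x) atTop atTop :=
        (tendsto_natCast_atTop_atTop.atTop_add tendsto_const_nhds).atTop_mul_const h0
      filter_upwards [this.eventually_gt_atTop 2] with n hn
      have hcont : Continuous fun y => ((n : ℝ) + 1) * l y := continuous_const.mul hl.continuous
      filter_upwards [(isOpen_lt continuous_const hcont).mem_nhds hn] with y hy
      exact cutoff_of_ge (le_of_lt hy)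
    rw [hΩ] at hx
    filter_upwards [hl h₁ hx.1, hl h₂ hx.2.1, hl h₃ hx.2.2] with n e1 e2 e3
    filter_upwards [e1, e2, e3] with y f1 f2 f3
    simp [θ, f1, f2, f3]
  have hsupp : ∀ (n : ℕ), tsupport (fun y => θ n y * U y) ⊆ Ω := by
    intro n
    have hn : (0 : ℝ) < n + 1 := by positivity
    have hcl : IsClosed {x | 1 ≤ (n + 1 : ℝ) * l₁ x ∧ 1 ≤ (n + 1 : ℝ) * l₂ x ∧
        1 ≤ (n + 1 : ℝ) * l₃ x} :=
      (isClosed_le continuous_const (continuous_const.mul h₁.continuous)).inter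
        ((isClosed_le continuous_const (continuous_const.mul h₂.continuous)).inter
          (isClosed_le continuous_const (continuous_const.mul h₃.continuous)))
    refine (closure_minimal (fun x hx => ?_) hcl).trans fun x hx => ?_
    · refine ⟨?_, ?_, ?_⟩ <;>
      · by_contra h
        exact hx (by simp [θ, cutoff_of_le (le_of_not_ge h)])
    · rw [hΩ]
      have := fun {t : ℝ} (h : 1 ≤ ((n : ℝ) + 1) * t) =>
        pos_of_mul_pos_right (zero_lt_one.trans_le h) hn.le
      exact ⟨this hx.1, this hx.2.1, this hx.2.2⟩
  have hC0 : ∀ x ∈ Ω, 0 ≤ C := fun x hx => by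
    have h1 := (abs_nonneg _).trans (hC₁ x hx)
    rw [hΩ] at hx
    exact nonneg_of_mul_nonneg_left h1 hx.1
  have hL0 : 0 ≤ L := (abs_nonneg _).trans (hL₁ 0 0)
  have hMn : ∀ i, ∀ x ∈ Ω, 0 ≤ M i := fun i x hx => (norm_nonneg _).trans (hM i x hx)
  have nn : ∀ x ∈ Ω, 0 ≤ C * B * L := fun x hx => by
    have := hC0 x hx
    positivity
  -- The gradient of the cutoff grows like `n + 1`, but only where `l` is of order `1/(n+1)`; there
  -- `|U| ≤ C * l` compensates, and the product is bounded uniformly in `n`.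
  have hcut : ∀ {l : Plane → ℝ}, ContDiff ℝ ∞ l → (∀ i x, |pderiv i l x| ≤ L) →
      ∀ (n : ℕ), ∀ x ∈ Ω, 0 < l x → |U x| ≤ C * l x → ∀ i,
      |pderiv i (fun y => cutoff ((n + 1 : ℝ) * l y)) x * U x| ≤ C * B * L := by
    intro l hl hL n x hx h0 hCl i
    rw [pderiv_comp_smul contDiff_cutoff hl, abs_mul]
    calc |((n : ℝ) + 1) * deriv cutoff ((n + 1 : ℝ) * l x) * pderiv i l x| * |U x|
        ≤ |((n : ℝ) + 1) * deriv cutoff ((n + 1 : ℝ) * l x) * pderiv i l x| * (C * l x) := by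
          gcongr
      _ = C * |((n + 1 : ℝ) * l x) * deriv cutoff ((n + 1 : ℝ) * l x)| * |pderiv i l x| := by
          simp only [abs_mul, abs_of_pos h0]
          ring
      _ ≤ C * B * L := by
          have := hC0 x hx
          gcongr
          · exact hB _
          · exact hL i x
  refine mem_topologicalClosure_testGraph ho hb hU hp1 hp2
    (ψ := fun n y => θ n y * U y) (C := M₀ + (3 * (C * B * L) + (M 0 + M 1)))
    (fun n => ⟨(hθ n).mul hU, ?_, hsupp n⟩) ?_ ?_ ?_ ?_
  · exact Metric.isCompact_of_isClosed_isBounded (isClosed_tsupport _) (hb.subset (hsupp n))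
  · intro n x hx
    have := nn x hx
    rw [abs_mul]
    nlinarith [hθ1 n x, abs_nonneg (U x), hM₀ x hx, Real.norm_eq_abs (U x), hMn 0 x hx, hMn 1 x hx]
  · intro i n x hx
    rw [pderiv_mul (hθ n) hU]
    have hMi : |pderiv i U x| ≤ M 0 + M 1 := by
      refine (hM i x hx).trans ?_
      fin_cases i
      · simpa using hMn 1 x hx
      · simpa using hMn 0 x hx
    have e2 : |θ n x * pderiv i U x| ≤ M 0 + M 1 := by
      rw [abs_mul]
      exact (mul_le_of_le_one_left (abs_nonneg _) (hθ1 n x)).trans hMi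
    have e1 : |pderiv i (θ n) x * U x| ≤ 3 * (C * B * L) := by
      have hx' := hx
      rw [hΩ] at hx'
      have d1 := hcut h₁ hL₁ n x hx hx'.1 (hC₁ x hx) i
      have d2 := hcut h₂ hL₂ n x hx hx'.2.1 (hC₂ x hx) i
      have d3 := hcut h₃ hL₃ n x hx hx'.2.2 (hC₃ x hx) i
      rw [pderiv_mul (hsm h₁ _) ((hsm h₂ _).mul (hsm h₃ _)), pderiv_mul (hsm h₂ _) (hsm h₃ _)]
      have a1 := abs_cutoff_le ((n + 1 : ℝ) * l₁ x)
      have a2 := abs_cutoff_le ((n + 1 : ℝ) * l₂ x)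
      have a3 := abs_cutoff_le ((n + 1 : ℝ) * l₃ x)
      have hprod : ∀ {D c c' : ℝ}, |D * U x| ≤ C * B * L → |c| ≤ 1 → |c'| ≤ 1 →
          |D * U x * (c * c')| ≤ C * B * L := by
        intro D c c' hD hc hc'
        rw [abs_mul, abs_mul c]
        exact (mul_le_of_le_one_right (abs_nonneg _)
          (mul_le_one₀ hc (abs_nonneg _) hc')).trans hD
      have t1 := hprod d1 a2 a3
      have t2 := hprod d2 a1 a3
      have t3 := hprod d3 a1 a2
      refine le_trans (le_of_eq (congrArg abs ?_)) ((abs_add_three _ _ _).trans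
        ((add_le_add_three t1 t2 t3).trans_eq ?_)) <;> ring
    refine (abs_add_le _ _).trans ((add_le_add e1 e2).trans ?_)
    have := (norm_nonneg _).trans (hM₀ x hx)
    linarith
  · intro x hx
    refine tendsto_const_nhds.congr' ?_
    filter_upwards [hev x hx] with n hn using hn.self_of_nhds.symm
  · intro i x hx
    refine tendsto_const_nhds.congr' ?_
    filter_upwards [hev x hx] with n hn
    rw [pderiv, pderiv, hn.fderiv_eq]

end Cutoff

/-! ### Orthogonal coordinates on the triangle and the explicit modes. -/

section Chart

open Filter Topology

/-- The affine function `z ↦ ⟪v, z⟫ + c` on the plane. -/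
noncomputable def affineCoord (v : Plane) (c : ℝ) (z : Plane) : ℝ := inner ℝ v z + c

/-- In the orthogonal coordinates `X = ⟪v, ·⟫ + c` and `Y = ⟪w, ·⟫ + d`, whose gradients have
squared length `κ`, the domain `Ω` is the triangle `0 < Y < X < π`. -/
structure IsTriangleChart (κ : ℝ) (v w : Plane) (c d : ℝ) (Ω : Set Plane) : Prop where
  pos : 0 < κ
  inner_left : inner ℝ v v = κ
  inner_right : inner ℝ w w = κ
  inner_eq_zero : inner ℝ v w = 0
  eq : Ω = {z | 0 < affineCoord w d z ∧ 0 < affineCoord v c z - affineCoord w d z ∧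
    0 < Real.pi - affineCoord v c z}

/-- The function `sin(mX) sin(nY) - sin(nX) sin(mY)`. -/
noncomputable def triangleMode (v w : Plane) (c d : ℝ) (m n : ℤ) (z : Plane) : ℝ :=
  Real.sin (m * affineCoord v c z) * Real.sin (n * affineCoord w d z) -
    Real.sin (n * affineCoord v c z) * Real.sin (m * affineCoord w d z)

theorem contDiff_affineCoord (v : Plane) (c : ℝ) : ContDiff ℝ ∞ (affineCoord v c) :=
  (contDiff_const.inner ℝ contDiff_id).add contDiff_const

theorem hasFDerivAt_affineCoord (v : Plane) (c : ℝ) (z : Plane) :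
    HasFDerivAt (affineCoord v c) (innerSL ℝ v) z :=
  (innerSL ℝ v).hasFDerivAt.add_const c

theorem pderiv_affineCoord (v : Plane) (c : ℝ) (i : Fin 2) (z : Plane) :
    pderiv i (affineCoord v c) z = v i := by
  rw [pderiv, (hasFDerivAt_affineCoord v c z).fderiv]
  simp [EuclideanSpace.inner_single_right]

variable (v w : Plane) (c d : ℝ) (m n : ℤ)

theorem contDiff_triangleMode : ContDiff ℝ ∞ (triangleMode v w c d m n) := by
  have := contDiff_affineCoord v c
  have := contDiff_affineCoord w d
  unfold triangleMode
  fun_prop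

theorem pderiv_triangleMode (i : Fin 2) : pderiv i (triangleMode v w c d m n) = fun z =>
    v i * (m * (Real.cos (m * affineCoord v c z) * Real.sin (n * affineCoord w d z)) -
      n * (Real.cos (n * affineCoord v c z) * Real.sin (m * affineCoord w d z))) +
    w i * (n * (Real.sin (m * affineCoord v c z) * Real.cos (n * affineCoord w d z)) -
      m * (Real.sin (n * affineCoord v c z) * Real.cos (m * affineCoord w d z))) := by
  funext z
  have hX := hasFDerivAt_affineCoord v c z
  have hY := hasFDerivAt_affineCoord w d z
  have := (((hX.const_mul (m : ℝ)).sin.mul (hY.const_mul (n : ℝ)).sin).sub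
    ((hX.const_mul (n : ℝ)).sin.mul (hY.const_mul (m : ℝ)).sin)).fderiv
  rw [pderiv]
  erw [this]
  simp [EuclideanSpace.inner_single_right]
  ring

theorem pderiv_pderiv_triangleMode (i : Fin 2) (z : Plane) :
    pderiv i (pderiv i (triangleMode v w c d m n)) z =
      -((v i * v i) * (m ^ 2 * (Real.sin (m * affineCoord v c z) * Real.sin (n * affineCoord w d z))
        - n ^ 2 * (Real.sin (n * affineCoord v c z) * Real.sin (m * affineCoord w d z)))) +
      (v i * w i) * (2 * m * n * (Real.cos (m * affineCoord v c z) * Real.cos (n * affineCoord w d z)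
        - Real.cos (n * affineCoord v c z) * Real.cos (m * affineCoord w d z))) -
      (w i * w i) * (n ^ 2 * (Real.sin (m * affineCoord v c z) * Real.sin (n * affineCoord w d z))
        - m ^ 2 * (Real.sin (n * affineCoord v c z) * Real.sin (m * affineCoord w d z))) := by
  rw [pderiv_triangleMode]
  have hX := hasFDerivAt_affineCoord v c z
  have hY := hasFDerivAt_affineCoord w d z
  have := (((((hX.const_mul (m : ℝ)).cos.mul (hY.const_mul (n : ℝ)).sin).const_mul (m : ℝ)).sub
    (((hX.const_mul (n : ℝ)).cos.mul (hY.const_mul (m : ℝ)).sin).const_mul (n : ℝ))).const_mul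
      (v i)).add
    (((((hX.const_mul (m : ℝ)).sin.mul (hY.const_mul (n : ℝ)).cos).const_mul (n : ℝ)).sub
    (((hX.const_mul (n : ℝ)).sin.mul (hY.const_mul (m : ℝ)).cos).const_mul (m : ℝ))).const_mul
      (w i)) |>.fderiv
  rw [pderiv]
  erw [this]
  simp [EuclideanSpace.inner_single_right]
  ring

variable {κ : ℝ} {v w : Plane} {c d : ℝ} {Ω : Set Plane}

namespace IsTriangleChart

variable (h : IsTriangleChart κ v w c d Ω)
include h

theorem laplacian_triangleMode (z : Plane) :
    ∑ i, pderiv i (pderiv i (triangleMode v w c d m n)) z =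
      -(κ * (m ^ 2 + n ^ 2)) * triangleMode v w c d m n z := by
  have h1 := h.inner_left
  have h2 := h.inner_right
  have h3 := h.inner_eq_zero
  simp only [PiLp.inner_apply, Fin.sum_univ_two, RCLike.inner_apply, conj_trivial] at h1 h2 h3
  simp only [Fin.sum_univ_two, pderiv_pderiv_triangleMode, triangleMode]
  set S := Real.sin (m * affineCoord v c z) * Real.sin (n * affineCoord w d z)
  set S' := Real.sin (n * affineCoord v c z) * Real.sin (m * affineCoord w d z)
  set T := Real.cos (m * affineCoord v c z) * Real.cos (n * affineCoord w d z)
    - Real.cos (n * affineCoord v c z) * Real.cos (m * affineCoord w d z)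
  linear_combination (-(m ^ 2 * S - n ^ 2 * S')) * h1 - (n ^ 2 * S - m ^ 2 * S') * h2
    + 2 * m * n * T * h3

theorem isOpen : IsOpen Ω := by
  rw [h.eq]
  have h1 := (contDiff_affineCoord v c).continuous
  have h2 := (contDiff_affineCoord w d).continuous
  exact (isOpen_lt continuous_const h2).inter ((isOpen_lt continuous_const (h1.sub h2)).inter
    (isOpen_lt continuous_const (continuous_const.sub h1)))

theorem parseval (z : Plane) : (inner ℝ v z) ^ 2 + (inner ℝ w z) ^ 2 = κ * ‖z‖ ^ 2 := by
  have h1 := h.inner_left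
  have h2 := h.inner_right
  have h3 := h.inner_eq_zero
  have hκ := h.pos.ne'
  rw [EuclideanSpace.norm_sq_eq]
  simp only [PiLp.inner_apply, Fin.sum_univ_two, RCLike.inner_apply, conj_trivial,
    Real.norm_eq_abs, sq_abs] at *
  -- The matrix with rows `v`, `w` is `√κ` times an orthogonal matrix, so its columns are orthogonal
  -- of squared length `κ` as well. `e1'` and `e2'` are these column relations.
  have e1 : κ * (v 1 * v 1 - w 0 * w 0) = 0 := by
    linear_combination (w 0 * w 0) * h1 - (v 1 * v 1) * h2 + (v 1 * w 1 - v 0 * w 0) * h3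
  have e1' := (mul_eq_zero.1 e1).resolve_left hκ
  have e2 : κ * (v 0 * v 1 + w 0 * w 1) = 0 := by
    linear_combination -(v 0 * v 1) * h2 - (w 0 * w 1) * h1 + (v 1 * w 0 + v 0 * w 1) * h3
  have e2' := (mul_eq_zero.1 e2).resolve_left hκ
  linear_combination (z 0 ^ 2) * (h1 - e1') + (z 1 ^ 2) * (h2 + e1') + 2 * z 0 * z 1 * e2'

/-- The closed triangle is bounded. -/
theorem isBounded_closed : Bornology.IsBounded {z | 0 ≤ affineCoord w d z ∧
    affineCoord w d z ≤ affineCoord v c z ∧ affineCoord v c z ≤ Real.pi} := by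
  have hκ := h.pos
  refine isBounded_iff_forall_norm_le.2
    ⟨√(((Real.pi + |c|) ^ 2 + (Real.pi + |d|) ^ 2) / κ), fun z hz => ?_⟩
  obtain ⟨h1, h2, h3⟩ := hz
  refine Real.le_sqrt_of_sq_le ?_
  rw [le_div_iff₀ hκ, mul_comm, ← h.parseval z]
  have hX : |inner ℝ v z| ≤ Real.pi + |c| := by
    have : inner ℝ v z = affineCoord v c z - c := by simp [affineCoord]
    rw [this]
    refine (abs_sub _ _).trans ?_
    rw [abs_of_nonneg (h1.trans h2)]
    linarith
  have hY : |inner ℝ w z| ≤ Real.pi + |d| := by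
    have : inner ℝ w z = affineCoord w d z - d := by simp [affineCoord]
    rw [this]
    refine (abs_sub _ _).trans ?_
    rw [abs_of_nonneg h1]
    linarith
  exact add_le_add (sq_le_sq.2 (hX.trans (le_abs_self _))) (sq_le_sq.2 (hY.trans (le_abs_self _)))

theorem isBounded : Bornology.IsBounded Ω :=
  h.isBounded_closed.subset fun z hz => by
    rw [h.eq] at hz
    exact ⟨hz.1.le, by linarith [hz.2.1], by linarith [hz.2.2]⟩

theorem eq_of_affineCoord_eq {z z' : Plane} (h1 : affineCoord v c z = affineCoord v c z')
    (h2 : affineCoord w d z = affineCoord w d z') : z = z' := by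
  have h3 := h.parseval (z - z')
  simp only [affineCoord] at h1 h2
  rw [inner_sub_right, inner_sub_right, add_right_cancel h1, add_right_cancel h2] at h3
  have := (mul_eq_zero.1 (by linarith : κ * ‖z - z'‖ ^ 2 = 0)).resolve_left h.pos.ne'
  exact sub_eq_zero.1 (norm_eq_zero.1 (pow_eq_zero_iff two_ne_zero |>.1 this))

/-- The mode vanishes on `Y = 0`, `X = Y` and `X = π`. Since the sine is 1-Lipschitz and bounded by
one, this vanishing is at least linear; on each side the mode is written as `a * s - b * t` with
`s`, `t` the small factors. -/
theorem abs_triangleMode_le {z : Plane} (hz : z ∈ Ω) :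
    |triangleMode v w c d m n z| ≤ (|(m : ℝ)| + |(n : ℝ)|) * affineCoord w d z ∧
    |triangleMode v w c d m n z| ≤
      (|(m : ℝ)| + |(n : ℝ)|) * (affineCoord v c z - affineCoord w d z) ∧
    |triangleMode v w c d m n z| ≤ (|(m : ℝ)| + |(n : ℝ)|) * (Real.pi - affineCoord v c z) := by
  rw [h.eq] at hz
  obtain ⟨h1, h2, h3⟩ := hz
  unfold triangleMode
  set x := affineCoord v c z
  set y := affineCoord w d z
  have key : ∀ {a b p q s t : ℝ} {l : ℝ}, 0 ≤ l → |a| ≤ 1 → |b| ≤ 1 → |s| ≤ |p| * l → |t| ≤ |q| * l →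
      |a * s - b * t| ≤ (|p| + |q|) * l := by
    intro a b p q s t l hl ha hb hs ht
    refine (abs_sub _ _).trans ?_
    rw [abs_mul, abs_mul, add_mul]
    exact add_le_add ((mul_le_of_le_one_left (abs_nonneg _) ha).trans hs)
      ((mul_le_of_le_one_left (abs_nonneg _) hb).trans ht)
  have hsin : ∀ (k : ℤ) (t s : ℝ), 0 < t - s →
      |Real.sin (k * t) - Real.sin (k * s)| ≤ |(k : ℝ)| * (t - s) := by
    intro k t s hts
    have h0 := Real.lipschitzWith_sin.dist_le_mul (k * t) (k * s)
    rwa [Real.dist_eq, Real.dist_eq, NNReal.coe_one, one_mul, ← mul_sub, abs_mul,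
      abs_of_pos hts] at h0
  refine ⟨?_, ?_, ?_⟩
  · rw [add_comm |(m : ℝ)|]
    refine key h1.le (Real.abs_sin_le_one _) (Real.abs_sin_le_one _) ?_ ?_
    · simpa using hsin n y 0 (by simpa using h1)
    · simpa using hsin m y 0 (by simpa using h1)
  · have e : Real.sin (m * x) * Real.sin (n * y) - Real.sin (n * x) * Real.sin (m * y) =
      Real.sin (n * y) * (Real.sin (m * x) - Real.sin (m * y)) -
        Real.sin (m * y) * (Real.sin (n * x) - Real.sin (n * y)) := by ring
    rw [e]
    exact key h2.le (Real.abs_sin_le_one _) (Real.abs_sin_le_one _) (hsin m x y h2) (hsin n x y h2)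
  · rw [mul_comm (Real.sin (m * x)), mul_comm (Real.sin (n * x))]
    have hs : ∀ k : ℤ, |Real.sin (k * x)| ≤ |(k : ℝ)| * (Real.pi - x) := fun k => by
      have := hsin k Real.pi x h3
      rwa [Real.sin_int_mul_pi, zero_sub, abs_neg] at this
    exact key h3.le (Real.abs_sin_le_one _) (Real.abs_sin_le_one _) (hs m) (hs n)

end IsTriangleChart

end Chart

/-! ### Completeness of the modes by Stone–Weierstrass. -/

section Completeness

open Filter Topology

variable {κ : ℝ} {v w : Plane} {c d : ℝ} {Ω : Set Plane}

/-- Product-to-sum identities: multiplication by a symmetric function of `cos X` and `cos Y` shifts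
the indices and respects the antisymmetry. This identity and the next make both elementary symmetric
functions multipliers of the span of the modes. -/
theorem two_mul_cos_add_cos_mul_triangleMode (v w : Plane) (c d : ℝ) (m n : ℤ) (z : Plane) :
    2 * ((Real.cos (affineCoord v c z) + Real.cos (affineCoord w d z)) *
      triangleMode v w c d m n z) =
    triangleMode v w c d (m + 1) n z + triangleMode v w c d (m - 1) n z +
      (triangleMode v w c d m (n + 1) z + triangleMode v w c d m (n - 1) z) := by
  simp only [triangleMode]
  push_cast
  simp only [add_mul, sub_mul, one_mul, Real.sin_add, Real.sin_sub]
  ring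

theorem four_mul_cos_mul_cos_mul_triangleMode (v w : Plane) (c d : ℝ) (m n : ℤ) (z : Plane) :
    4 * ((Real.cos (affineCoord v c z) * Real.cos (affineCoord w d z)) *
      triangleMode v w c d m n z) =
    triangleMode v w c d (m + 1) (n + 1) z + triangleMode v w c d (m - 1) (n + 1) z +
      (triangleMode v w c d (m + 1) (n - 1) z + triangleMode v w c d (m - 1) (n - 1) z) := by
  simp only [triangleMode]
  push_cast
  simp only [add_mul, sub_mul, one_mul, Real.sin_add, Real.sin_sub]
  ring

/-- The subalgebra of multipliers of a subspace of an algebra. -/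
def multiplierSubalgebra {A : Type*} [CommRing A] [Algebra ℝ A] (V : Submodule ℝ A) :
    Subalgebra ℝ A where
  carrier := {f | ∀ g ∈ V, f * g ∈ V}
  mul_mem' := fun {a b} ha hb g hg => by
    rw [mul_assoc]
    exact ha _ (hb g hg)
  add_mem' := fun {a b} ha hb g hg => by
    rw [add_mul]
    exact V.add_mem (ha g hg) (hb g hg)
  algebraMap_mem' := fun r g hg => by
    rw [← Algebra.smul_def]
    exact V.smul_mem r hg

theorem mem_multiplierSubalgebra_span {A : Type*} [CommRing A] [Algebra ℝ A] {S : Set A} {f : A}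
    (h : ∀ g ∈ S, f * g ∈ Submodule.span ℝ S) :
    f ∈ multiplierSubalgebra (Submodule.span ℝ S) := fun g hg => by
  induction hg using Submodule.span_induction with
  | mem g hg => exact h g hg
  | zero => rw [mul_zero]; exact Submodule.zero_mem _
  | add x y _ _ hx hy => rw [mul_add]; exact Submodule.add_mem _ hx hy
  | smul r x _ hx => rw [mul_smul_comm]; exact Submodule.smul_mem _ r hx

/-- `triangleMode` as a continuous function. -/
noncomputable def triangleModeMap (v w : Plane) (c d : ℝ) (p : ℤ × ℤ) : C(Plane, ℝ) :=
  ⟨triangleMode v w c d p.1 p.2, (contDiff_triangleMode v w c d p.1 p.2).continuous⟩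

namespace IsTriangleChart

variable (h : IsTriangleChart κ v w c d Ω)
include h

theorem memLp {U : Plane → ℝ} (hU : Continuous U) : MemLp U 2 (volume.restrict Ω) :=
  hU.memLp_two_of_isBounded h.isOpen h.isBounded

/-- `triangleMode` as an element of `L²(Ω)`. -/
noncomputable def modeLp (m n : ℤ) : L2 Ω :=
  (h.memLp (contDiff_triangleMode v w c d m n).continuous).toLp _

theorem coeFn_modeLp (m n : ℤ) :
    h.modeLp m n =ᵐ[volume.restrict Ω] triangleMode v w c d m n := MemLp.coeFn_toLp _

/-- The gradient of `triangleMode` in `L²(Ω)`. -/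
noncomputable def gradModeLp (m n : ℤ) (i : Fin 2) : L2 Ω :=
  (h.memLp (contDiff_pderiv (contDiff_triangleMode v w c d m n) i).continuous).toLp _

/-- The Hessian of `triangleMode` in `L²(Ω)`. -/
noncomputable def hessModeLp (m n : ℤ) (i j : Fin 2) : L2 Ω :=
  (h.memLp (contDiff_pderiv (contDiff_pderiv (contDiff_triangleMode v w c d m n) i)
    j).continuous).toLp _

theorem coeFn_gradModeLp (m n : ℤ) (i : Fin 2) :
    h.gradModeLp m n i =ᵐ[volume.restrict Ω] pderiv i (triangleMode v w c d m n) :=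
  MemLp.coeFn_toLp _

theorem coeFn_hessModeLp (m n : ℤ) (i j : Fin 2) :
    h.hessModeLp m n i j =ᵐ[volume.restrict Ω] pderiv j (pderiv i (triangleMode v w c d m n)) :=
  MemLp.coeFn_toLp _

theorem isWeakDeriv_modeLp (m n : ℤ) (i : Fin 2) :
    IsWeakDeriv Ω i (h.modeLp m n) (h.gradModeLp m n i) :=
  isWeakDeriv_of_contDiff (contDiff_triangleMode v w c d m n) (h.coeFn_modeLp m n)
    (h.coeFn_gradModeLp m n i)

theorem isWeakDeriv_gradModeLp (m n : ℤ) (i j : Fin 2) :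
    IsWeakDeriv Ω j (h.gradModeLp m n i) (h.hessModeLp m n i j) :=
  isWeakDeriv_of_contDiff (contDiff_pderiv (contDiff_triangleMode v w c d m n) i)
    (h.coeFn_gradModeLp m n i) (h.coeFn_hessModeLp m n i j)

theorem laplacian_modeLp (m n : ℤ) :
    ∑ i, h.hessModeLp m n i i + (κ * (m ^ 2 + n ^ 2)) • h.modeLp m n = 0 := by
  refine Lp.ext ?_
  rw [Fin.sum_univ_two]
  filter_upwards [Lp.coeFn_add (h.hessModeLp m n 0 0 + h.hessModeLp m n 1 1)
    ((κ * (m ^ 2 + n ^ 2)) • h.modeLp m n), Lp.coeFn_add (h.hessModeLp m n 0 0)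
    (h.hessModeLp m n 1 1), Lp.coeFn_smul (κ * ((m : ℝ) ^ 2 + (n : ℝ) ^ 2)) (h.modeLp m n),
    h.coeFn_modeLp m n, h.coeFn_hessModeLp m n 0 0, h.coeFn_hessModeLp m n 1 1,
    Lp.coeFn_zero ℝ 2 (volume.restrict Ω)] with z e1 e2 e3 e4 e5 e6 e7
  rw [e1, Pi.add_apply, e2, Pi.add_apply, e3, Pi.smul_apply, e4, e5, e6, e7]
  have := h.laplacian_triangleMode m n z
  rw [Fin.sum_univ_two] at this
  rw [this]
  simp

theorem modeLp_mem_closure (m n : ℤ) :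
    (h.modeLp m n, h.gradModeLp m n) ∈ (testGraph Ω).topologicalClosure := by
  have hX := contDiff_affineCoord v c
  have hY := contDiff_affineCoord w d
  have hb : ∀ (u : Plane) (i : Fin 2), |u i| ≤ ‖u‖ := fun u i => PiLp.norm_apply_le u i
  have e1 : ∀ i z, pderiv i (fun z => affineCoord v c z - affineCoord w d z) z = v i - w i := by
    intro i z
    have := ((hasFDerivAt_affineCoord v c z).sub (hasFDerivAt_affineCoord w d z)).fderiv
    rw [pderiv]
    erw [this]
    simp [EuclideanSpace.inner_single_right]
  have e2 : ∀ i z, pderiv i (fun z => Real.pi - affineCoord v c z) z = - v i := by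
    intro i z
    have := ((hasFDerivAt_affineCoord v c z).const_sub Real.pi).fderiv
    rw [pderiv]
    erw [this]
    simp [EuclideanSpace.inner_single_right]
  refine mem_closure_of_abs_le_mul h.isBounded hY (hX.sub hY) (contDiff_const.sub hX) h.eq
    (L := ‖v‖ + ‖w‖) ?_ ?_ ?_ (contDiff_triangleMode v w c d m n)
    (fun z hz => (h.abs_triangleMode_le m n hz).1) (fun z hz => (h.abs_triangleMode_le m n hz).2.1)
    (fun z hz => (h.abs_triangleMode_le m n hz).2.2) (h.coeFn_modeLp m n)
    (h.coeFn_gradModeLp m n)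
  · intro i z
    rw [pderiv_affineCoord]
    linarith [hb w i, norm_nonneg v]
  · intro i z
    rw [e1]
    exact (abs_sub _ _).trans (add_le_add (hb v i) (hb w i))
  · intro i z
    rw [e2, abs_neg]
    linarith [hb v i, norm_nonneg w]

theorem modeLp_mem_dirichletEigenspace (m n : ℤ) :
    h.modeLp m n ∈ dirichletEigenspace Ω (κ * (m ^ 2 + n ^ 2)) :=
  ⟨⟨_, h.modeLp_mem_closure m n, rfl⟩, h.gradModeLp m n, h.hessModeLp m n,
    h.isWeakDeriv_modeLp m n, h.isWeakDeriv_gradModeLp m n, h.laplacian_modeLp m n⟩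

theorem inner_modeLp_eq_zero {lam : ℝ} {u : L2 Ω} (hu : u ∈ dirichletEigenspace Ω lam) {m n : ℤ}
    (hne : κ * (m ^ 2 + n ^ 2) ≠ lam) : inner ℝ u (h.modeLp m n) = 0 :=
  inner_eq_zero_of_mem_dirichletEigenspace h.isOpen h.isBounded hu (h.modeLp_mem_closure m n)
    (k := fun i => h.hessModeLp m n i i) (fun i => h.isWeakDeriv_gradModeLp m n i i)
    (h.laplacian_modeLp m n) hne

/-- The mode `(2, 1)` factors as `2 sin X sin Y (cos X - cos Y)`, and each factor has a constant
sign for `0 < Y < X < π`. -/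
theorem triangleMode_two_one_ne_zero {z : Plane} (hz : z ∈ Ω) :
    triangleMode v w c d 2 1 z ≠ 0 := by
  rw [h.eq] at hz
  obtain ⟨h1, h2, h3⟩ := hz
  have e : triangleMode v w c d 2 1 z = 2 * (Real.sin (affineCoord v c z) *
      Real.sin (affineCoord w d z)) *
      (Real.cos (affineCoord v c z) - Real.cos (affineCoord w d z)) := by
    simp only [triangleMode]
    push_cast
    rw [Real.sin_two_mul, Real.sin_two_mul, one_mul, one_mul]
    ring
  have s1 := Real.sin_pos_of_pos_of_lt_pi (x := affineCoord v c z) (by linarith) (by linarith)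
  have s2 := Real.sin_pos_of_pos_of_lt_pi (x := affineCoord w d z) (by linarith) (by linarith)
  have s3 := Real.cos_lt_cos_of_nonneg_of_le_pi h1.le (by linarith : affineCoord v c z ≤ Real.pi)
    (by linarith)
  rw [e]
  exact mul_ne_zero (by positivity) (by linarith)

/-- Continuous functions are uniformly approximated on the triangle by multipliers of the span of
the modes. -/
theorem exists_multiplier_near (F : C(Plane, ℝ)) {ε : ℝ} (hε : 0 < ε) :
    ∃ f ∈ multiplierSubalgebra (Submodule.span ℝ (range (triangleModeMap v w c d))),
      ∀ z ∈ Ω, |f z - F z| < ε := by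
  set K := {z | 0 ≤ affineCoord w d z ∧
    affineCoord w d z ≤ affineCoord v c z ∧ affineCoord v c z ≤ Real.pi} with hK
  have hX := (contDiff_affineCoord v c).continuous
  have hY := (contDiff_affineCoord w d).continuous
  have hKc : IsClosed K := (isClosed_le continuous_const hY).inter
    ((isClosed_le hY hX).inter (isClosed_le hX continuous_const))
  have : CompactSpace K :=
    isCompact_iff_compactSpace.1 (Metric.isCompact_of_isClosed_isBounded hKc h.isBounded_closed)
  set A := multiplierSubalgebra (Submodule.span ℝ (range (triangleModeMap v w c d))) with hA
  -- The elementary symmetric functions of `cos X` and `cos Y`.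
  let f₁ : C(Plane, ℝ) := ⟨fun z => Real.cos (affineCoord v c z) + Real.cos (affineCoord w d z),
    by fun_prop⟩
  let f₂ : C(Plane, ℝ) := ⟨fun z => Real.cos (affineCoord v c z) * Real.cos (affineCoord w d z),
    by fun_prop⟩
  have hmem : ∀ m n, triangleModeMap v w c d (m, n) ∈
      Submodule.span ℝ (range (triangleModeMap v w c d)) := fun m n =>
    Submodule.subset_span ⟨_, rfl⟩
  have hf₁ : f₁ ∈ A := by
    refine mem_multiplierSubalgebra_span ?_
    rintro _ ⟨⟨m, n⟩, rfl⟩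
    have e : f₁ * triangleModeMap v w c d (m, n) = (2 : ℝ)⁻¹ •
        (triangleModeMap v w c d (m + 1, n) + triangleModeMap v w c d (m - 1, n) +
        (triangleModeMap v w c d (m, n + 1) + triangleModeMap v w c d (m, n - 1))) := by
      ext z
      have := two_mul_cos_add_cos_mul_triangleMode v w c d m n z
      simp only [ContinuousMap.mul_apply, ContinuousMap.smul_apply, ContinuousMap.add_apply,
        triangleModeMap, ContinuousMap.coe_mk, f₁, smul_eq_mul, ← this]
      ring
    rw [e]
    exact Submodule.smul_mem _ _ (Submodule.add_mem _ (Submodule.add_mem _ (hmem _ _) (hmem _ _))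
      (Submodule.add_mem _ (hmem _ _) (hmem _ _)))
  have hf₂ : f₂ ∈ A := by
    refine mem_multiplierSubalgebra_span ?_
    rintro _ ⟨⟨m, n⟩, rfl⟩
    have e : f₂ * triangleModeMap v w c d (m, n) = (4 : ℝ)⁻¹ •
        (triangleModeMap v w c d (m + 1, n + 1) + triangleModeMap v w c d (m - 1, n + 1) +
        (triangleModeMap v w c d (m + 1, n - 1) + triangleModeMap v w c d (m - 1, n - 1))) := by
      ext z
      have := four_mul_cos_mul_cos_mul_triangleMode v w c d m n z
      simp only [ContinuousMap.mul_apply, ContinuousMap.smul_apply, ContinuousMap.add_apply,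
        triangleModeMap, ContinuousMap.coe_mk, f₂, smul_eq_mul, ← this]
      ring
    rw [e]
    exact Submodule.smul_mem _ _ (Submodule.add_mem _ (Submodule.add_mem _ (hmem _ _) (hmem _ _))
      (Submodule.add_mem _ (hmem _ _) (hmem _ _)))
  let ι : C(K, Plane) := ⟨Subtype.val, continuous_subtype_val⟩
  let ρ := ContinuousMap.compRightAlgHom ℝ ℝ ι
  -- Sum and product determine the unordered pair `{cos X, cos Y}`; on the closed triangle `Y ≤ X`
  -- forces `cos X ≤ cos Y`, which orders it, and the cosine is injective on `[0, π]`.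
  have hsep : (A.map ρ).SeparatesPoints := by
    intro z z' hne
    by_contra! hcon
    have e1 : f₁ z.1 = f₁ z'.1 := hcon _ ⟨ρ f₁, ⟨f₁, hf₁, rfl⟩, rfl⟩
    have e2 : f₂ z.1 = f₂ z'.1 := hcon _ ⟨ρ f₂, ⟨f₂, hf₂, rfl⟩, rfl⟩
    simp only [f₁, f₂, ContinuousMap.coe_mk] at e1 e2
    obtain ⟨z, hz1, hz2, hz3⟩ := z
    obtain ⟨z', hz1', hz2', hz3'⟩ := z'
    simp only at e1 e2
    have m1 := Real.cos_le_cos_of_nonneg_of_le_pi hz1 hz3 hz2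
    have m2 := Real.cos_le_cos_of_nonneg_of_le_pi hz1' hz3' hz2'
    have key : Real.cos (affineCoord v c z) = Real.cos (affineCoord v c z') ∧
        Real.cos (affineCoord w d z) = Real.cos (affineCoord w d z') := by
      generalize Real.cos (affineCoord v c z) = a at *
      generalize Real.cos (affineCoord w d z) = b at *
      generalize Real.cos (affineCoord v c z') = a' at *
      generalize Real.cos (affineCoord w d z') = b' at *
      have hsq : (b - a) ^ 2 = (b' - a') ^ 2 := by
        linear_combination (a + b + a' + b') * e1 - 4 * e2
      have := (sq_eq_sq₀ (by linarith) (by linarith)).1 hsq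
      constructor <;> linarith
    refine hne (Subtype.ext (h.eq_of_affineCoord_eq ?_ ?_))
    · exact Real.injOn_cos ⟨hz1.trans hz2, hz3⟩ ⟨hz1'.trans hz2', hz3'⟩ key.1
    · exact Real.injOn_cos ⟨hz1, hz2.trans hz3⟩ ⟨hz1', hz2'.trans hz3'⟩ key.2
  obtain ⟨⟨_, f, hf, rfl⟩, hfε⟩ :=
    ContinuousMap.exists_mem_subalgebra_near_continuousMap_of_separatesPoints (A.map ρ) hsep
      (F.comp ι) ε hε
  refine ⟨f, hf, fun z hz => ?_⟩
  rw [h.eq] at hz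
  have hzK : z ∈ K := ⟨hz.1.le, by linarith [hz.2.1], by linarith [hz.2.2]⟩
  exact (ContinuousMap.norm_coe_le_norm _ (⟨z, hzK⟩ : K)).trans_lt hfε

/-- The modes are complete in `L²(Ω)`. -/
theorem eq_zero_of_forall_inner_modeLp {u : L2 Ω} (hu : ∀ m n, inner ℝ u (h.modeLp m n) = 0) :
    u = 0 := by
  have hint : ∀ f : C(Plane, ℝ), Integrable (fun z => u z * f z) (volume.restrict Ω) := fun f =>
    (Lp.memLp u).integrable_mul (h.memLp f.continuous)
  have hV : ∀ f ∈ Submodule.span ℝ (range (triangleModeMap v w c d)),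
      ∫ z in Ω, u z * f z = 0 := by
    intro f hf
    induction hf using Submodule.span_induction with
    | mem f hf =>
      obtain ⟨⟨m, n⟩, rfl⟩ := hf
      rw [← hu m n]
      exact (inner_eq_integral_of_ae_eq (h.coeFn_modeLp m n)).symm
    | zero => simp
    | add f g _ _ hf hg =>
      simp only [ContinuousMap.add_apply, mul_add]
      rw [integral_add (hint f) (hint g), hf, hg, add_zero]
    | smul r f _ hf =>
      simp only [ContinuousMap.smul_apply, smul_eq_mul, mul_left_comm _ r]
      rw [integral_const_mul, hf, mul_zero]
  -- The span of the modes is not an algebra, so density is tested against `u * W` for a fixed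
  -- zero-free mode `W`: for a multiplier `f`, the function `f * W` is again in the span, hence
  -- orthogonal to `u`. Approximating `φ` by such `f` gives `u * W = 0` almost everywhere.
  set W := triangleModeMap v w c d (2, 1) with hW
  have hzero : ∀ φ : C(Plane, ℝ), ∫ z in Ω, u z * W z * φ z = 0 := by
    intro φ
    set I := ∫ z in Ω, |u z * W z| with hI
    have hI0 : 0 ≤ I := integral_nonneg fun _ => abs_nonneg _
    have hbd : ∀ ε > 0, |∫ z in Ω, u z * W z * φ z| ≤ ε * I := by
      intro ε hε
      obtain ⟨f, hf, hfε⟩ := h.exists_multiplier_near φ hε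
      have h0 := hV _ (hf W (Submodule.subset_span ⟨_, rfl⟩))
      have e : ∫ z in Ω, u z * W z * φ z = ∫ z in Ω, u z * W z * (φ z - f z) := by
        have e1 : ∀ z, u z * W z * (φ z - f z) = u z * (W * φ) z - u z * (f * W) z := fun z => by
          simp only [ContinuousMap.mul_apply]
          ring
        simp only [e1]
        rw [integral_sub (hint _) (hint _), h0, sub_zero]
        simp only [ContinuousMap.mul_apply, mul_assoc]
      rw [e, hI, ← integral_const_mul, ← Real.norm_eq_abs]
      refine norm_integral_le_of_norm_le ((hint W).abs.const_mul ε)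
        ((ae_restrict_iff' h.isOpen.measurableSet).2 (.of_forall fun z hz => ?_))
      rw [Real.norm_eq_abs, abs_mul, mul_comm ε]
      refine mul_le_mul_of_nonneg_left ?_ (abs_nonneg _)
      rw [abs_sub_comm]
      exact (hfε z hz).le
    refine abs_eq_zero.1 (le_antisymm (le_of_forall_pos_le_add fun δ hδ => ?_) (abs_nonneg _))
    refine (hbd (δ / (I + 1)) (by positivity)).trans ?_
    rw [zero_add, div_mul_eq_mul_div, div_le_iff₀ (by positivity)]
    nlinarith
  have hW : IntegrableOn (fun z => u z * W z) Ω := hint W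
  have hae := ae_eq_zero_of_integral_testFunction (f := fun z => u z * W z) h.isOpen
    hW.locallyIntegrableOn fun φ hφ => hzero ⟨φ, hφ.smooth.continuous⟩
  refine Lp.ext ?_
  filter_upwards [hae, ae_restrict_mem h.isOpen.measurableSet,
    Lp.coeFn_zero ℝ 2 (volume.restrict Ω)] with z hz hzΩ h0
  rw [h0]
  exact (mul_eq_zero.1 hz).resolve_right (h.triangleMode_two_one_ne_zero hzΩ)

end IsTriangleChart

end Completeness

/-! ### Independence of the modes and the dimension of the eigenspaces. -/

section Multiplicity

open Filter Topology

/-- Pairs `(m, n)` with `m > n ≥ 1`. -/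
abbrev TrianglePair : Type := {p : ℕ × ℕ // 0 < p.2 ∧ p.2 < p.1}

theorem finite_trianglePair_fiber {κ : ℝ} (hκ : 0 < κ) (lam : ℝ) :
    Finite {p : TrianglePair // κ * ((p.1.1 : ℝ) ^ 2 + (p.1.2 : ℝ) ^ 2) = lam} := by
  obtain ⟨N, hN⟩ := exists_nat_ge (lam / κ)
  have hf : (Set.Iic N ×ˢ Set.Iic N : Set (ℕ × ℕ)).Finite := (finite_Iic N).prod (finite_Iic N)
  have := hf.to_subtype
  refine Finite.of_injective (β := (Set.Iic N ×ˢ Set.Iic N : Set (ℕ × ℕ)))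
    (fun p => ⟨p.1.1, ?_⟩) fun p q hpq => Subtype.ext (Subtype.ext (Subtype.mk.inj hpq))
  have h1 : ((p.1.1.1 : ℝ) ^ 2 + (p.1.1.2 : ℝ) ^ 2) ≤ N :=
    (eq_div_of_mul_eq hκ.ne' ((mul_comm _ _).trans p.2)).trans_le hN
  have h2 : p.1.1.1 ^ 2 + p.1.1.2 ^ 2 ≤ N := by exact_mod_cast h1
  constructor <;> simp only [mem_Iic] <;> nlinarith

/-- Because `sin((m+1)x) = U_m(cos x) sin x` with `U_m` of degree `m`, a relation on any interval
becomes a polynomial with infinitely many roots. Orthogonality of sines would need all of `(0, π)`,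
whereas a slice of the triangle at height `y` only gives `x` in `(y, π)`. -/
theorem eq_zero_of_sum_sin_succ {N : ℕ} {b : ℕ → ℝ} {α : ℝ} (h0 : 0 ≤ α) (hα : α < Real.pi)
    (h : ∀ x, α < x → x < Real.pi → ∑ m ∈ Finset.range N, b m * Real.sin ((m + 1 : ℕ) * x) = 0) :
    ∀ m < N, b m = 0 := by
  let S : Polynomial.Sequence ℝ :=
    ⟨fun n => Polynomial.Chebyshev.U ℝ n, fun n => Polynomial.Chebyshev.degree_U_natCast ℝ n⟩
  have hS : ∀ n, S n = Polynomial.Chebyshev.U ℝ n := fun n => rfl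
  have hP : ∑ m ∈ Finset.range N, b m • S m = 0 := by
    have hinf : (Real.cos '' Ioo α Real.pi).Infinite :=
      (Ioo_infinite hα).image (Real.injOn_cos.mono
        (Ioo_subset_Icc_self.trans (Icc_subset_Icc_left h0)))
    refine Polynomial.eq_zero_of_infinite_isRoot _ (hinf.mono ?_)
    rintro _ ⟨x, hx, rfl⟩
    have hs := (Real.sin_pos_of_pos_of_lt_pi (h0.trans_lt hx.1) hx.2).ne'
    refine (mul_eq_zero.1 (?_ : _ * Real.sin x = 0)).resolve_right hs
    rw [Polynomial.eval_finsetSum, Finset.sum_mul, ← h x hx.1 hx.2]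
    refine Finset.sum_congr rfl fun m _ => ?_
    rw [Polynomial.eval_smul, smul_eq_mul, mul_assoc, hS, Polynomial.Chebyshev.U_real_cos]
    push_cast
    rfl
  intro m hm
  exact linearIndependent_iff'.1 S.linearIndependent (Finset.range N) b hP m (Finset.mem_range.2 hm)

theorem eq_zero_of_sum_sin {N : ℕ} {b : ℕ → ℝ} {α : ℝ} (h0 : 0 ≤ α) (hα : α < Real.pi)
    (h : ∀ x, α < x → x < Real.pi → ∑ m ∈ Finset.range N, b m * Real.sin (m * x) = 0) :
    ∀ m, 0 < m → m < N → b m = 0 := by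
  intro m hm hmN
  obtain ⟨N, rfl⟩ : ∃ k, N = k + 1 := ⟨N - 1, by omega⟩
  obtain ⟨m, rfl⟩ : ∃ k, m = k + 1 := ⟨m - 1, by omega⟩
  refine eq_zero_of_sum_sin_succ (b := fun m => b (m + 1)) (N := N) h0 hα (fun x h1 h2 => ?_) m
    (by omega)
  have := h x h1 h2
  rw [Finset.sum_range_succ'] at this
  simpa using this

theorem eq_zero_of_sum_sin_mul_sin {N : ℕ} {b : ℕ → ℕ → ℝ}
    (h : ∀ x y, 0 < y → y < x → x < Real.pi → ∑ m ∈ Finset.range N, ∑ n ∈ Finset.range N,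
      b m n * (Real.sin (m * x) * Real.sin (n * y)) = 0) :
    ∀ m n, 0 < m → m < N → 0 < n → n < N → b m n = 0 := by
  intro m n hm hmN hn hnN
  refine eq_zero_of_sum_sin le_rfl Real.pi_pos (fun y h1 h2 => ?_) n hn hnN (b := b m)
  refine eq_zero_of_sum_sin h1.le h2 (fun x h3 h4 => ?_) m hm hmN
    (b := fun m => ∑ n ∈ Finset.range N, b m n * Real.sin (n * y))
  rw [← h x y h1 h3 h4]
  refine Finset.sum_congr rfl fun i _ => ?_
  rw [Finset.sum_mul]
  exact Finset.sum_congr rfl fun j _ => by ring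

variable {κ : ℝ} {v w : Plane} {c d : ℝ} {Ω : Set Plane}

namespace IsTriangleChart

variable (h : IsTriangleChart κ v w c d Ω)
include h

theorem exists_affineCoord_eq (x y : ℝ) : ∃ z, affineCoord v c z = x ∧ affineCoord w d z = y := by
  have hκ := h.pos.ne'
  refine ⟨((x - c) / κ) • v + ((y - d) / κ) • w, ?_, ?_⟩
  · rw [affineCoord, inner_add_right, real_inner_smul_right, real_inner_smul_right, h.inner_left,
      h.inner_eq_zero]
    field_simp
    ring
  · rw [affineCoord, inner_add_right, real_inner_smul_right, real_inner_smul_right, h.inner_right,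
      real_inner_comm, h.inner_eq_zero]
    field_simp
    ring

/-- An almost everywhere relation between continuous functions holds at every point of the open set
`Ω`. Expanding the modes gives a double sine sum with the antisymmetrized coefficients `b m n - b n
m`; for `m > n` the second term is zero, so the first must vanish. -/
theorem linearIndependent_modeLp :
    LinearIndependent ℝ fun p : TrianglePair => h.modeLp p.1.1 p.1.2 := by
  classical
  refine linearIndependent_iff'.2 fun s g hg p hp => ?_
  have hae : (fun z => ∑ p ∈ s, g p * triangleMode v w c d p.1.1 p.1.2 z)
      =ᵐ[volume.restrict Ω] fun _ => 0 := by
    have h1 := Lp.coeFn_finsetSum s fun p : TrianglePair => g p • h.modeLp p.1.1 p.1.2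
    have h2 : ∀ p : TrianglePair, ∀ᵐ z ∂volume.restrict Ω, (g p • h.modeLp p.1.1 p.1.2 : L2 Ω) z
        = g p * triangleMode v w c d p.1.1 p.1.2 z := fun p => by
      filter_upwards [Lp.coeFn_smul (g p) (h.modeLp p.1.1 p.1.2), h.coeFn_modeLp p.1.1 p.1.2]
        with z e1 e2
      rw [e1, Pi.smul_apply, e2, smul_eq_mul]
    rw [hg] at h1
    filter_upwards [h1, Lp.coeFn_zero ℝ 2 (volume.restrict Ω), ae_all_iff.2 h2] with z e1 e2 e3
    rw [e2, Pi.zero_apply, Finset.sum_apply] at e1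
    rw [e1]
    exact Finset.sum_congr rfl fun p _ => (e3 p).symm
  have hev := Measure.eqOn_open_of_ae_eq hae h.isOpen
    (Continuous.continuousOn (continuous_finsetSum _ fun p _ =>
      continuous_const.mul (contDiff_triangleMode v w c d _ _).continuous)) continuousOn_const
  -- The coefficients `g`, extended by zero off `s` and off the pairs with `0 < j < i`.
  let b : ℕ → ℕ → ℝ := fun i j =>
    if hij : 0 < j ∧ j < i then (if ⟨(i, j), hij⟩ ∈ s then g ⟨(i, j), hij⟩ else 0) else 0
  have hb : ∀ q : TrianglePair, b q.1.1 q.1.2 = if q ∈ s then g q else 0 := fun q => by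
    simp only [b, dif_pos q.2]
  obtain ⟨N, hN⟩ : ∃ N, ∀ q ∈ s, q.1.1 < N := by
    refine ⟨s.sup (fun q => q.1.1) + 1, fun q hq => Nat.lt_succ_of_le ?_⟩
    exact Finset.le_sup (f := fun q : TrianglePair => q.1.1) hq
  have key : ∀ x y, 0 < y → y < x → x < Real.pi → ∑ m ∈ Finset.range N, ∑ n ∈ Finset.range N,
      (b m n - b n m) * (Real.sin (m * x) * Real.sin (n * y)) = 0 := by
    intro x y h1 h2 h3
    obtain ⟨z, hz1, hz2⟩ := h.exists_affineCoord_eq x y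
    have hzΩ : z ∈ Ω := by
      rw [h.eq]
      refine ⟨?_, ?_, ?_⟩ <;> linarith
    have e1 := hev hzΩ
    simp only [triangleMode, hz1, hz2, Int.cast_natCast] at e1
    let f : ℕ × ℕ → ℝ := fun q => b q.1 q.2 *
      (Real.sin (q.1 * x) * Real.sin (q.2 * y) - Real.sin (q.2 * x) * Real.sin (q.1 * y))
    have e2 : ∑ q ∈ Finset.range N ×ˢ Finset.range N, f q = 0 := by
      rw [← e1, ← Finset.sum_subset (s₁ := s.image Subtype.val),
        Finset.sum_image Subtype.val_injective.injOn]
      · exact Finset.sum_congr rfl fun q hq => by simp only [f, hb, if_pos hq]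
      · intro q hq
        obtain ⟨q, hqs, rfl⟩ := Finset.mem_image.1 hq
        exact Finset.mem_product.2 ⟨Finset.mem_range.2 (hN q hqs),
          Finset.mem_range.2 (q.2.2.trans (hN q hqs))⟩
      · intro q _ hq
        have : b q.1 q.2 = 0 := by
          simp only [b]
          split_ifs with h4 h5
          · exact absurd (Finset.mem_image.2 ⟨_, h5, rfl⟩) hq
          · rfl
          · rfl
        simp only [f, this, zero_mul]
    rw [Finset.sum_product] at e2
    simp only [sub_mul, Finset.sum_sub_distrib]
    rw [Finset.sum_comm (f := fun m n => b n m * (Real.sin (m * x) * Real.sin (n * y))), ← e2]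
    simp only [← Finset.sum_sub_distrib, f]
    exact Finset.sum_congr rfl fun i _ => Finset.sum_congr rfl fun j _ => by ring
  have h0 := eq_zero_of_sum_sin_mul_sin (b := fun m n => b m n - b n m) key p.1.1 p.1.2
    (p.2.1.trans p.2.2) (hN p hp) p.2.1 (p.2.2.trans (hN p hp))
  have h1 : b p.1.2 p.1.1 = 0 := dif_neg fun hc => hc.2.not_gt p.2.2
  simp only [h1, hb, if_pos hp, sub_zero] at h0
  exact h0

/-- Up to sign the mode is unchanged by swapping the indices or negating one of them, and it
vanishes if an index is zero or the two agree. So the pairs with `m > n ≥ 1` already account for all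
integer indices. -/
theorem eq_zero_of_forall_inner_modeLp_pair {u : L2 Ω}
    (hu : ∀ p : TrianglePair, inner ℝ u (h.modeLp p.1.1 p.1.2) = 0) : u = 0 := by
  refine h.eq_zero_of_forall_inner_modeLp ?_
  have hint : ∀ m n, inner ℝ u (h.modeLp m n) = ∫ z in Ω, u z * triangleMode v w c d m n z :=
    fun m n => inner_eq_integral_of_ae_eq (h.coeFn_modeLp m n)
  have hswap : ∀ m n, inner ℝ u (h.modeLp m n) = - inner ℝ u (h.modeLp n m) := fun m n => by
    rw [hint, hint, ← integral_neg]
    congr 1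
    funext z
    simp only [triangleMode]
    ring
  have hneg : ∀ m n, inner ℝ u (h.modeLp (-m) n) = - inner ℝ u (h.modeLp m n) := fun m n => by
    rw [hint, hint, ← integral_neg]
    congr 1
    funext z
    simp only [triangleMode, Int.cast_neg, neg_mul, Real.sin_neg]
    ring
  have hzero : ∀ n, inner ℝ u (h.modeLp 0 n) = 0 := fun n => by
    have := hneg 0 n
    rw [neg_zero] at this
    linarith
  have hlt : ∀ m n : ℕ, n < m → inner ℝ u (h.modeLp m n) = 0 := fun m n hmn => by
    rcases Nat.eq_zero_or_pos n with rfl | hn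
    · rw [hswap, Nat.cast_zero, hzero, neg_zero]
    · exact hu ⟨(m, n), hn, hmn⟩
  have hnat : ∀ m n : ℕ, inner ℝ u (h.modeLp m n) = 0 := fun m n => by
    rcases lt_trichotomy m n with hmn | rfl | hmn
    · rw [hswap, hlt n m hmn, neg_zero]
    · linarith [hswap m m]
    · exact hlt m n hmn
  have hleft : ∀ (m : ℤ) (n : ℕ), inner ℝ u (h.modeLp m n) = 0 := fun m n => by
    obtain ⟨k, rfl | rfl⟩ := m.eq_nat_or_neg
    · exact hnat k n
    · rw [hneg, hnat, neg_zero]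
  intro m n
  obtain ⟨k, rfl | rfl⟩ := n.eq_nat_or_neg
  · exact hleft m k
  · rw [hswap, hneg, hswap, hleft, neg_zero, neg_zero, neg_zero]

/-- Subtract from an eigenfunction its projection onto the span of the modes with the same
eigenvalue. The rest is orthogonal to those modes by construction and to all others by Green's
formula, hence zero by completeness. No abstract spectral theorem is needed. -/
theorem dirichletEigenspace_eq (lam : ℝ) : dirichletEigenspace Ω lam =
    Submodule.span ℝ (range fun p : {p : TrianglePair //
      κ * ((p.1.1 : ℝ) ^ 2 + (p.1.2 : ℝ) ^ 2) = lam} => h.modeLp p.1.1.1 p.1.1.2) := by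
  have := finite_trianglePair_fiber h.pos lam
  set F := Submodule.span ℝ (range fun p : {p : TrianglePair //
      κ * ((p.1.1 : ℝ) ^ 2 + (p.1.2 : ℝ) ^ 2) = lam} => h.modeLp p.1.1.1 p.1.1.2) with hF
  have hle : F ≤ dirichletEigenspace Ω lam := by
    refine Submodule.span_le.2 ?_
    rintro _ ⟨⟨p, rfl⟩, rfl⟩
    exact_mod_cast h.modeLp_mem_dirichletEigenspace p.1.1 p.1.2
  refine le_antisymm (fun u hu => ?_) hle
  have hfd : FiniteDimensional ℝ F := FiniteDimensional.span_of_finite ℝ (finite_range _)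
  have hproj : F.starProjection u ∈ F := Submodule.starProjection_apply_mem _ _
  have hsub : u - F.starProjection u ∈ dirichletEigenspace Ω lam :=
    Submodule.sub_mem _ hu (hle hproj)
  have : u - F.starProjection u = 0 := by
    refine h.eq_zero_of_forall_inner_modeLp_pair fun p => ?_
    by_cases hp : κ * ((p.1.1 : ℝ) ^ 2 + (p.1.2 : ℝ) ^ 2) = lam
    · exact Submodule.starProjection_inner_eq_zero _ _ (Submodule.subset_span ⟨⟨p, hp⟩, rfl⟩)
    · exact h.inner_modeLp_eq_zero hsub (by exact_mod_cast hp)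
  rw [sub_eq_zero.1 this]
  exact hproj

theorem finiteDimensional_dirichletEigenspace (lam : ℝ) :
    FiniteDimensional ℝ (dirichletEigenspace Ω lam) := by
  have := finite_trianglePair_fiber h.pos lam
  rw [h.dirichletEigenspace_eq]
  exact FiniteDimensional.span_of_finite ℝ (finite_range _)

theorem finrank_dirichletEigenspace (lam : ℝ) : Module.finrank ℝ (dirichletEigenspace Ω lam) =
    Nat.card {p : TrianglePair // κ * ((p.1.1 : ℝ) ^ 2 + (p.1.2 : ℝ) ^ 2) = lam} := by
  have := finite_trianglePair_fiber h.pos lam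
  have := Fintype.ofFinite {p : TrianglePair // κ * ((p.1.1 : ℝ) ^ 2 + (p.1.2 : ℝ) ^ 2) = lam}
  rw [h.dirichletEigenspace_eq, Nat.card_eq_fintype_card]
  exact finrank_span_eq_card (h.linearIndependent_modeLp.comp _ Subtype.val_injective)

theorem mem_dirichletSpectrum_iff (lam : ℝ) : lam ∈ dirichletSpectrum Ω ↔
    ∃ p : TrianglePair, κ * ((p.1.1 : ℝ) ^ 2 + (p.1.2 : ℝ) ^ 2) = lam := by
  have := h.finiteDimensional_dirichletEigenspace lam
  have := finite_trianglePair_fiber h.pos lam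
  rw [dirichletSpectrum, mem_ofPred_eq, ← nonempty_subtype, ← Nat.card_pos_iff.trans
    (and_iff_left this), ← h.finrank_dirichletEigenspace, Module.finrank_pos_iff,
    Submodule.nontrivial_iff_ne_bot]

theorem pos_of_mem_dirichletSpectrum {lam : ℝ} (hl : lam ∈ dirichletSpectrum Ω) : 0 < lam := by
  obtain ⟨p, rfl⟩ := (h.mem_dirichletSpectrum_iff lam).1 hl
  have h1 : (0 : ℝ) < p.1.2 := by exact_mod_cast p.2.1
  have := h.pos
  positivity

end IsTriangleChart

end Multiplicity

/-! ### Sums over the square lattice and their symmetries. -/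

section LatticeSums

open Filter Topology

theorem ofReal_cpow_two_mul {x : ℝ} (hx : 0 < x) (s : ℂ) :
    (x : ℂ) ^ (2 * s) = ((x ^ 2 : ℝ) : ℂ) ^ s := by
  rw [two_mul, Complex.cpow_add _ _ (Complex.ofReal_ne_zero.2 hx.ne'),
    ← Complex.mul_cpow_ofReal_nonneg hx.le hx.le, Complex.ofReal_pow, sq]

/-- The power `(m² + n²) ^ (-s)` (which vanishes for `m = n = 0` if `s ≠ 0`). -/
noncomputable def sumSqTerm (s : ℂ) (p : ℤ × ℤ) : ℂ := (((p.1 : ℝ) ^ 2 + (p.2 : ℝ) ^ 2 : ℝ) : ℂ) ^ (-s)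

variable {s : ℂ}

theorem sumSqTerm_zero (hs : s ≠ 0) : sumSqTerm s 0 = 0 := by
  simp [sumSqTerm, hs]

theorem sumSq_pos {p : ℤ × ℤ} (hp : p ≠ 0) : 0 < (p.1 : ℝ) ^ 2 + (p.2 : ℝ) ^ 2 := by
  by_cases h : p.1 = 0
  · have h2 : p.2 ≠ 0 := fun h2 => hp (Prod.ext h h2)
    positivity
  · positivity

/-- The Euclidean norm dominates the sup norm, for which the lattice sum with exponent `2 Re s > 2`
is known to converge. -/
theorem summable_sumSqTerm (hs : 1 < s.re) : Summable (sumSqTerm s) := by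
  have h := EisensteinSeries.summable_one_div_norm_rpow (k := 2 * s.re) (by linarith)
  rw [← (finTwoArrowEquiv ℤ).symm.summable_iff] at h
  refine h.of_norm_bounded fun p => ?_
  have hs0 : s ≠ 0 := fun h => by norm_num [h] at hs
  rcases eq_or_ne p 0 with rfl | hp
  · rw [sumSqTerm_zero hs0, norm_zero]
    exact Real.rpow_nonneg (norm_nonneg _) _
  have hq := sumSq_pos hp
  set x : Fin 2 → ℤ := (finTwoArrowEquiv ℤ).symm p with hx
  have hx0 : 0 < ‖x‖ := norm_pos_iff.2 fun h0 =>
    hp ((finTwoArrowEquiv ℤ).symm.injective (h0.trans (by ext i; fin_cases i <;> rfl)))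
  have hle : ‖x‖ ^ 2 ≤ (p.1 : ℝ) ^ 2 + (p.2 : ℝ) ^ 2 := by
    have : ‖x‖ ≤ √((p.1 : ℝ) ^ 2 + (p.2 : ℝ) ^ 2) := by
      refine (pi_norm_le_iff_of_nonneg (Real.sqrt_nonneg _)).2 fun i => ?_
      rw [Int.norm_eq_abs]
      refine Real.abs_le_sqrt ?_
      fin_cases i
      · exact le_add_of_nonneg_right (sq_nonneg _)
      · exact le_add_of_nonneg_left (sq_nonneg _)
    exact (Real.le_sqrt (norm_nonneg _) hq.le).1 this
  rw [sumSqTerm, Complex.norm_cpow_eq_rpow_re_of_pos hq, Complex.neg_re, Function.comp_apply,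
    ← mul_neg, Real.rpow_mul (norm_nonneg _), Real.rpow_two]
  exact Real.rpow_le_rpow_of_nonpos (by positivity) hle (by linarith)

theorem latticeTerm_eq (s : ℂ) {p : ℤ × ℤ} (hp : p ≠ 0) :
    latticeTerm s p = ((Real.pi : ℂ) ^ (2 * s))⁻¹ * sumSqTerm s p := by
  have hq := sumSq_pos hp
  have hn : ‖(p.1 : ℂ) + (p.2 : ℂ) * Complex.I‖ ^ 2 = (p.1 : ℝ) ^ 2 + (p.2 : ℝ) ^ 2 := by
    rw [← Complex.normSq_eq_norm_sq]
    have := Complex.normSq_add_mul_I (p.1 : ℝ) (p.2 : ℝ)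
    exact_mod_cast this
  have hpos : 0 < ‖(p.1 : ℂ) + (p.2 : ℂ) * Complex.I‖ := by
    refine (norm_nonneg _).lt_of_ne fun h0 => ?_
    rw [← h0] at hn
    norm_num at hn
    linarith
  rw [latticeTerm, sumSqTerm, ofReal_cpow_two_mul hpos, hn, Complex.cpow_neg, one_div, mul_inv]

theorem summable_latticeTerm (hs : 1 < s.re) :
    Summable (fun p : {p : ℤ × ℤ // p ≠ 0} => latticeTerm s p) :=
  (((summable_sumSqTerm hs).mul_left _).subtype _).congr fun p => (latticeTerm_eq s p.2).symm

/-- The double series `∑_{m, n ≥ 1} (m² + n²) ^ (-s)`. -/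
noncomputable def quadrantSum (s : ℂ) : ℂ :=
  ∑' p : ℕ+ × ℕ+, sumSqTerm s ((p.1 : ℕ), (p.2 : ℕ))

theorem summable_quadrant (hs : 1 < s.re) :
    Summable fun p : ℕ+ × ℕ+ => sumSqTerm s ((p.1 : ℕ), (p.2 : ℕ)) := by
  refine (summable_sumSqTerm hs).comp_injective
    (i := fun p : ℕ+ × ℕ+ => (((p.1 : ℕ) : ℤ), ((p.2 : ℕ) : ℤ))) fun p q hpq => ?_
  simpa [Prod.ext_iff] using hpq

theorem tsum_sumSqTerm_axis (hs : 1 < (2 * s).re) :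
    ∑' n : ℕ+, sumSqTerm s (0, (n : ℕ)) = riemannZeta (2 * s) := by
  rw [zeta_eq_tsum_one_div_nat_add_one_cpow hs,
    tsum_pnat_eq_tsum_succ (f := fun n : ℕ => sumSqTerm s (0, n))]
  refine tsum_congr fun n => ?_
  have := ofReal_cpow_two_mul (x := n + 1) (by positivity) s
  push_cast at this
  simp [sumSqTerm, Complex.cpow_neg, this]

theorem sumSqTerm_swap (s : ℂ) (m n : ℤ) : sumSqTerm s (m, n) = sumSqTerm s (n, m) := by
  simp only [sumSqTerm, add_comm]

theorem sumSqTerm_neg_right (s : ℂ) (m n : ℤ) : sumSqTerm s (m, -n) = sumSqTerm s (m, n) := by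
  simp [sumSqTerm]

theorem sumSqTerm_neg_left (s : ℂ) (m n : ℤ) : sumSqTerm s (-m, n) = sumSqTerm s (m, n) := by
  simp [sumSqTerm]

/-- Four open quadrants and four half-axes; each half-axis contributes `ζ(2s)`, and the origin
contributes nothing. -/
theorem tsum_sumSqTerm (hs : 1 < s.re) :
    ∑' p, sumSqTerm s p = 4 * quadrantSum s + 4 * riemannZeta (2 * s) := by
  have hS := summable_sumSqTerm hs
  have h2 : 1 < (2 * s).re := by
    simp only [Complex.mul_re, Complex.re_ofNat, Complex.im_ofNat, zero_mul, sub_zero]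
    linarith
  have hs0 : s ≠ 0 := fun h => by norm_num [h] at hs
  have hinner : ∀ m : ℤ, ∑' n : ℤ, sumSqTerm s (m, n) =
      sumSqTerm s (m, 0) + 2 * ∑' n : ℕ+, sumSqTerm s (m, (n : ℕ)) := fun m =>
    (tsum_int_eq_zero_add_two_mul_tsum_pnat (fun n => sumSqTerm_neg_right s m n)
      (hS.prod_factor m)).trans (by rw [nsmul_eq_mul, Nat.cast_ofNat])
  have hQ := summable_quadrant hs
  have hcol : Summable fun m : ℕ+ => sumSqTerm s ((m : ℕ), 0) :=
    hS.comp_injective (i := fun m : ℕ+ => (((m : ℕ) : ℤ), (0 : ℤ))) fun p q hpq => by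
      simpa using hpq
  rw [hS.tsum_prod, tsum_int_eq_zero_add_two_mul_tsum_pnat
    (fun m => by simp only [sumSqTerm_neg_left]) hS.prod, nsmul_eq_mul, Nat.cast_ofNat]
  simp only [hinner]
  rw [(show sumSqTerm s (0, 0) = 0 from sumSqTerm_zero hs0), tsum_sumSqTerm_axis h2,
    Summable.tsum_add hcol (hQ.prod.mul_left 2), tsum_mul_left, ← hQ.tsum_prod, ← quadrantSum]
  simp only [sumSqTerm_swap s _ 0]
  rw [tsum_sumSqTerm_axis h2]
  ring

theorem latticeG_eq (hs : 1 < s.re) : latticeG s =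
    ((Real.pi : ℂ) ^ (2 * s))⁻¹ * (4 * quadrantSum s + 4 * riemannZeta (2 * s)) := by
  have hs0 : s ≠ 0 := fun h => by norm_num [h] at hs
  rw [← tsum_sumSqTerm hs, ← tsum_mul_left, latticeG]
  rw [tsum_congr fun p : {p : ℤ × ℤ // p ≠ 0} => latticeTerm_eq s p.2]
  refine tsum_subtype_eq_of_support_subset (s := {p : ℤ × ℤ | p ≠ 0})
    (f := fun p => ((Real.pi : ℂ) ^ (2 * s))⁻¹ * sumSqTerm s p) fun p hp h0 => hp ?_
  simp only [h0, sumSqTerm_zero hs0, mul_zero]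

theorem summable_trianglePair (hs : 1 < s.re) :
    Summable fun p : TrianglePair => sumSqTerm s (p.1.1, p.1.2) := by
  refine (summable_sumSqTerm hs).comp_injective
    (i := fun p : TrianglePair => ((p.1.1 : ℤ), (p.1.2 : ℤ))) fun p q hpq => ?_
  simpa [Prod.ext_iff, Subtype.ext_iff] using hpq

/-- The diagonal `m = n` splits the quadrant into two mirror halves and itself contributes `∑
(2n²)^(-s)`. -/
theorem quadrantSum_eq (hs : 1 < s.re) : quadrantSum s =
    2 * ∑' p : TrianglePair, sumSqTerm s (p.1.1, p.1.2) + (2 : ℂ) ^ (-s) * riemannZeta (2 * s) := by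
  have h2 : 1 < (2 * s).re := by
    simp only [Complex.mul_re, Complex.re_ofNat, Complex.im_ofNat, zero_mul, sub_zero]
    linarith
  have hQ := summable_quadrant hs
  set f : ℕ+ × ℕ+ → ℂ := fun p => sumSqTerm s ((p.1 : ℕ), (p.2 : ℕ)) with hf
  have hdec : ∀ p, f p = {p : ℕ+ × ℕ+ | p.2 < p.1}.indicator f p +
      {p : ℕ+ × ℕ+ | p.1 < p.2}.indicator f p + {p : ℕ+ × ℕ+ | p.1 = p.2}.indicator f p := by
    intro p
    rcases lt_trichotomy p.1 p.2 with h | h | h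
    · simp [indicator, h, h.ne, h.not_gt]
    · simp [indicator, h]
    · simp [indicator, h, h.ne', h.not_gt]
  have e1 : ∑' p, {p : ℕ+ × ℕ+ | p.2 < p.1}.indicator f p =
      ∑' p : TrianglePair, sumSqTerm s (p.1.1, p.1.2) := by
    let g : TrianglePair → ℕ+ × ℕ+ := fun p => (⟨p.1.1, p.2.1.trans p.2.2⟩, ⟨p.1.2, p.2.1⟩)
    have hg : Function.Injective g := fun p q hpq => by
      have h1 := congrArg (fun r : ℕ+ × ℕ+ => (r.1 : ℕ)) hpq
      have h2 := congrArg (fun r : ℕ+ × ℕ+ => (r.2 : ℕ)) hpq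
      exact Subtype.ext (Prod.ext h1 h2)
    rw [← hg.tsum_eq]
    · exact tsum_congr fun p => indicator_of_mem (show g p ∈ {p : ℕ+ × ℕ+ | p.2 < p.1} from p.2.2) f
    · intro p hp
      have : p ∈ {p : ℕ+ × ℕ+ | p.2 < p.1} := mem_of_indicator_ne_zero hp
      exact ⟨⟨(p.1, p.2), p.2.2, this⟩, rfl⟩
  have e2 : ∑' p, {p : ℕ+ × ℕ+ | p.1 < p.2}.indicator f p =
      ∑' p, {p : ℕ+ × ℕ+ | p.2 < p.1}.indicator f p := by
    rw [← (Equiv.prodComm ℕ+ ℕ+).tsum_eq]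
    refine tsum_congr fun p => ?_
    simp only [indicator, Equiv.prodComm_apply, mem_ofPred_eq, Prod.fst_swap, Prod.snd_swap, hf,
      sumSqTerm_swap s (p.2 : ℕ)]
  have e3 : ∑' p, {p : ℕ+ × ℕ+ | p.1 = p.2}.indicator f p =
      (2 : ℂ) ^ (-s) * riemannZeta (2 * s) := by
    have hg : Function.Injective fun n : ℕ+ => (n, n) := fun p q hpq => (Prod.ext_iff.1 hpq).1
    rw [← hg.tsum_eq, ← tsum_sumSqTerm_axis h2, ← tsum_mul_left]
    · refine tsum_congr fun n => ?_
      rw [indicator_of_mem (show ((n, n) : ℕ+ × ℕ+) ∈ {p : ℕ+ × ℕ+ | p.1 = p.2} from rfl) f]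
      have := Complex.mul_cpow_ofReal_nonneg (a := 2) (b := ((n : ℕ) : ℝ) ^ 2) zero_le_two
        (by positivity) (-s)
      simp only [hf, sumSqTerm]
      push_cast at this ⊢
      rw [← two_mul, this]
      ring_nf
    · intro p hp
      have : p ∈ {p : ℕ+ × ℕ+ | p.1 = p.2} := mem_of_indicator_ne_zero hp
      exact ⟨p.1, Prod.ext rfl this⟩
  rw [quadrantSum, tsum_congr hdec, Summable.tsum_add ((hQ.indicator _).add (hQ.indicator _))
    (hQ.indicator _), Summable.tsum_add (hQ.indicator _) (hQ.indicator _), e2, e1, e3]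
  ring

end LatticeSums

/-! ### The spectral zeta function as a sum over pairs. -/

section SpectralSum

open Filter Topology

/-- In barycentric parameters the chart is `X = π(1 - p)`, `Y = πq`. The reversed sign of `X` turns
the hypotenuse `p + q = 1` into `X = Y` and sends the right angle to `(π, 0)`. -/
theorem IsIsoscelesRightTriangle.exists_chart {a : ℝ} (ha : 0 < a) {Ω : Set Plane}
    (hΩ : IsIsoscelesRightTriangle a Ω) :
    ∃ v w c d, IsTriangleChart ((Real.pi / a) ^ 2) v w c d Ω := by
  obtain ⟨P, Q, R, hQ, hR, horth, rfl⟩ := hΩ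
  have hπ := Real.pi_pos
  rw [dist_comm, dist_eq_norm] at hQ hR
  have hQQ : inner ℝ (Q - P) (Q - P) = a ^ 2 := by rw [real_inner_self_eq_norm_sq, hQ]
  have hRR : inner ℝ (R - P) (R - P) = a ^ 2 := by rw [real_inner_self_eq_norm_sq, hR]
  set k := Real.pi / a ^ 2 with hk
  have hka : k * a ^ 2 = Real.pi := by rw [hk]; field_simp
  set v := (-k) • (Q - P) with hv
  set w := k • (R - P) with hw
  have hX : ∀ z, affineCoord v (Real.pi - inner ℝ v P) z =
      Real.pi - k * inner ℝ (Q - P) (z - P) := fun z => by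
    rw [affineCoord, inner_sub_right, hv, real_inner_smul_left, real_inner_smul_left]
    ring
  have hY : ∀ z, affineCoord w (- inner ℝ w P) z = k * inner ℝ (R - P) (z - P) := fun z => by
    rw [affineCoord, inner_sub_right, hw, real_inner_smul_left, real_inner_smul_left]
    ring
  have hchart : IsTriangleChart ((Real.pi / a) ^ 2) v w (Real.pi - inner ℝ v P) (- inner ℝ w P)
      {z | 0 < affineCoord w (- inner ℝ w P) z ∧
        0 < affineCoord v (Real.pi - inner ℝ v P) z - affineCoord w (- inner ℝ w P) z ∧
        0 < Real.pi - affineCoord v (Real.pi - inner ℝ v P) z} :=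
    { pos := by positivity
      inner_left := by
        rw [hv, real_inner_smul_left, real_inner_smul_right, hQQ, hk]
        field_simp
      inner_right := by
        rw [hw, real_inner_smul_left, real_inner_smul_right, hRR, hk]
        field_simp
      inner_eq_zero := by
        rw [hv, hw, real_inner_smul_left, real_inner_smul_right, horth]
        ring
      eq := rfl }
  refine ⟨v, w, Real.pi - inner ℝ v P, - inner ℝ w P, { hchart with eq := ?_ }⟩
  have hXp : ∀ p q : ℝ, affineCoord v (Real.pi - inner ℝ v P) (P + p • (Q - P) + q • (R - P)) =
      Real.pi * (1 - p) := fun p q => by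
    rw [hX, add_assoc, add_sub_cancel_left, inner_add_right, real_inner_smul_right,
      real_inner_smul_right, hQQ, horth]
    linear_combination -p * hka
  have hYp : ∀ p q : ℝ, affineCoord w (- inner ℝ w P) (P + p • (Q - P) + q • (R - P)) =
      Real.pi * q := fun p q => by
    rw [hY, add_assoc, add_sub_cancel_left, inner_add_right, real_inner_smul_right,
      real_inner_smul_right, hRR, real_inner_comm, horth]
    linear_combination q * hka
  ext z
  constructor
  · rintro ⟨p, q, hp, hq, hpq, rfl⟩
    rw [mem_ofPred_eq, hXp, hYp]
    exact ⟨by positivity, by nlinarith, by nlinarith⟩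
  · rintro ⟨h1, h2, h3⟩
    set x := affineCoord v (Real.pi - inner ℝ v P) z with hx
    set y := affineCoord w (- inner ℝ w P) z with hy
    refine ⟨(Real.pi - x) / Real.pi, y / Real.pi, by positivity, by positivity, ?_, ?_⟩
    · rw [← add_div, div_lt_one hπ]
      linarith
    · refine hchart.eq_of_affineCoord_eq ?_ ?_
      · rw [hXp, ← hx]
        field_simp
        ring
      · rw [hYp, ← hy]
        field_simp

variable {κ : ℝ} {v w : Plane} {c d : ℝ} {Ω : Set Plane} {s : ℂ}

/-- The convergent sum over pairs is regrouped along the fibres of the map from pairs to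
eigenvalues; the size of a fibre is the multiplicity. -/
theorem IsTriangleChart.hasSum_spectralZetaTerm (h : IsTriangleChart κ v w c d Ω)
    (hs : 1 < s.re) : HasSum (spectralZetaTerm Ω s)
      ((κ : ℂ) ^ (-s) * ∑' p : TrianglePair, sumSqTerm s (p.1.1, p.1.2)) := by
  set ev : TrianglePair → dirichletSpectrum Ω := fun p =>
    ⟨κ * ((p.1.1 : ℝ) ^ 2 + (p.1.2 : ℝ) ^ 2), (h.mem_dirichletSpectrum_iff _).2 ⟨p, rfl⟩⟩ with hev
  have hsum := ((summable_trianglePair hs).mul_left ((κ : ℂ) ^ (-s))).hasSum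
  rw [tsum_mul_left] at hsum
  have hterm : ∀ p : TrianglePair, (κ : ℂ) ^ (-s) * sumSqTerm s (p.1.1, p.1.2) =
      (((ev p : ℝ)) : ℂ) ^ (-s) := fun p => by
    rw [sumSqTerm, ← Complex.mul_cpow_ofReal_nonneg h.pos.le (by positivity), ← Complex.ofReal_mul]
    simp [hev]
  simp only [hterm] at hsum
  rw [← (Equiv.sigmaFiberEquiv ev).hasSum_iff] at hsum
  refine hsum.sigma fun lam => ?_
  have hfib : ∀ p : {p // ev p = lam},
      ((fun p => (((ev p : ℝ)) : ℂ) ^ (-s)) ∘ Equiv.sigmaFiberEquiv ev) ⟨lam, p⟩ =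
        ((lam : ℝ) : ℂ) ^ (-s) := fun p => by
    change (((ev p.1 : ℝ)) : ℂ) ^ (-s) = _
    rw [p.2]
  simp only [hfib]
  let e : {p // ev p = lam} ≃
      {p : TrianglePair // κ * ((p.1.1 : ℝ) ^ 2 + (p.1.2 : ℝ) ^ 2) = lam} :=
    Equiv.subtypeEquivRight fun p => Subtype.ext_iff
  have hfin := finite_trianglePair_fiber h.pos lam
  have := Finite.of_equiv _ e.symm
  have := Fintype.ofFinite {p // ev p = lam}
  rw [spectralZetaTerm, h.finrank_dirichletEigenspace, ← Nat.card_congr e, Nat.card_eq_fintype_card]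
  have hcard := hasSum_fintype (fun _ : {p // ev p = lam} => ((lam : ℝ) : ℂ) ^ (-s))
  rw [Finset.sum_const, nsmul_eq_mul, Finset.card_univ] at hcard
  exact hcard

end SpectralSum

/-! ### Bessel integrals, the divisor series and meromorphy. -/

section BesselIntegrals

open Filter Topology

/-- The kernel `exp (-c (x + 1/x))`. -/
noncomputable def besselKernel (c x : ℝ) : ℝ := Real.exp (-c * (x + x⁻¹))

theorem besselKernel_pos (c x : ℝ) : 0 < besselKernel c x := Real.exp_pos _

theorem continuousOn_besselKernel (c : ℝ) : ContinuousOn (besselKernel c) (Ioi 0) := by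
  refine Real.continuous_exp.comp_continuousOn (continuousOn_const.mul
    (continuousOn_id.add (continuousOn_id.inv₀ fun x hx => (mem_Ioi.1 hx).ne')))

theorem isBigO_besselKernel_atTop {c : ℝ} (hc : 0 < c) (b : ℝ) :
    besselKernel c =O[atTop] fun x : ℝ => x ^ b := by
  refine Asymptotics.IsBigO.trans (Asymptotics.IsBigO.of_bound 1 ?_)
    (isLittleO_exp_neg_mul_rpow_atTop hc b).isBigO
  filter_upwards [eventually_gt_atTop 0] with x hx
  rw [one_mul, Real.norm_of_nonneg (besselKernel_pos c x).le, Real.norm_of_nonneg (Real.exp_pos _).le]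
  refine Real.exp_le_exp.2 ?_
  have : 0 < c * x⁻¹ := by positivity
  linarith [mul_add c x x⁻¹]

/-- The kernel is invariant under `x ↦ 1/x`, so decay at zero is decay at infinity. Rapid decay at
both ends makes its Mellin transform entire. -/
theorem isBigO_besselKernel_zero {c : ℝ} (hc : 0 < c) (b : ℝ) :
    besselKernel c =O[𝓝[>] 0] fun x : ℝ => x ^ b := by
  have h := (isBigO_besselKernel_atTop hc (-b)).comp_tendsto tendsto_inv_nhdsGT_zero
  refine h.congr' ?_ ?_
  · exact .of_forall fun x => by
      simp only [Function.comp_apply, besselKernel, inv_inv, add_comm]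
  · filter_upwards [self_mem_nhdsWithin] with x hx
    rw [Function.comp_apply, Real.rpow_neg (inv_nonneg.2 (le_of_lt hx)),
      Real.inv_rpow (le_of_lt hx), inv_inv]

theorem mellinConvergent_besselKernel {c : ℝ} (hc : 0 < c) (s : ℂ) :
    MellinConvergent (fun x => (besselKernel c x : ℂ)) s :=
  mellinConvergent_of_isBigO_rpow (a := s.re + 1) (b := s.re - 1)
    ((Complex.continuous_ofReal.comp_continuousOn
      (continuousOn_besselKernel c)).locallyIntegrableOn measurableSet_Ioi)
    (Complex.isBigO_ofReal_left.2 (isBigO_besselKernel_atTop hc _)) (by linarith)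
    (Complex.isBigO_ofReal_left.2 (isBigO_besselKernel_zero hc _)) (by linarith)

theorem differentiable_mellin_besselKernel {c : ℝ} (hc : 0 < c) :
    Differentiable ℂ (mellin fun x => (besselKernel c x : ℂ)) := fun s =>
  mellin_differentiableAt_of_isBigO_rpow (a := s.re + 1) (b := s.re - 1)
    ((Complex.continuous_ofReal.comp_continuousOn
      (continuousOn_besselKernel c)).locallyIntegrableOn measurableSet_Ioi)
    (Complex.isBigO_ofReal_left.2 (isBigO_besselKernel_atTop hc _)) (by linarith)
    (Complex.isBigO_ofReal_left.2 (isBigO_besselKernel_zero hc _)) (by linarith)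

theorem integrableOn_rpow_mul_besselKernel {c : ℝ} (hc : 0 < c) (σ : ℝ) :
    IntegrableOn (fun x => x ^ σ * besselKernel c x) (Ioi 0) := by
  have h := (mellinConvergent_besselKernel hc ((σ + 1 : ℝ) : ℂ)).norm
  refine (integrableOn_congr_fun (fun x hx => ?_) measurableSet_Ioi).1 h
  simp only [norm_smul, Complex.norm_real]
  rw [Complex.norm_cpow_eq_rpow_re_of_pos hx, Real.norm_of_nonneg (besselKernel_pos c x).le]
  simp

theorem besselIntegrand_eq (s : ℂ) (n : ℕ+) (x : ℝ) : besselIntegrand s n x =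
    (x : ℂ) ^ (s - 1 / 2 - 1) • (besselKernel (Real.pi * n) x : ℂ) := by
  rw [besselIntegrand, besselKernel, smul_eq_mul]
  ring_nf

theorem integral_besselIntegrand (s : ℂ) (n : ℕ+) : ∫ x in Ioi (0 : ℝ), besselIntegrand s n x =
    mellin (fun x => (besselKernel (Real.pi * n) x : ℂ)) (s - 1 / 2) := by
  simp only [mellin, besselIntegrand_eq]

theorem integrableOn_besselIntegrand (s : ℂ) (n : ℕ+) :
    IntegrableOn (besselIntegrand s n) (Ioi 0) := by
  have := mellinConvergent_besselKernel (c := Real.pi * n) (by positivity) (s - 1 / 2)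
  simp only [MellinConvergent, ← besselIntegrand_eq] at this
  exact this

theorem two_le_add_inv {x : ℝ} (hx : 0 < x) : 2 ≤ x + x⁻¹ := by
  have : x + x⁻¹ - 2 = (x - 1) ^ 2 / x := by
    field_simp
    ring
  have h2 : 0 ≤ (x - 1) ^ 2 / x := by positivity
  linarith

theorem norm_besselIntegrand_le {s : ℂ} {R : ℝ} (h1 : -R ≤ s.re) (h2 : s.re ≤ R) (n : ℕ+) {x : ℝ}
    (hx : 0 < x) : ‖besselIntegrand s n x‖ ≤ Real.exp (-Real.pi * n) *
      (x ^ (R - 3 / 2) * besselKernel (Real.pi / 2) x +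
        x ^ (-R - 3 / 2) * besselKernel (Real.pi / 2) x) := by
  have hπ := Real.pi_pos
  have hn : (1 : ℝ) ≤ n := by exact_mod_cast n.2
  -- With `u = x + 1/x ≥ 2` and `n ≥ 1` one has `n * u ≥ n + u / 2`: one part gives decay in `n`,
  -- the other keeps the integral over `x` convergent independently of `n`.
  have hexp : Real.exp (-Real.pi * (n : ℕ) * (x + x⁻¹)) ≤
      Real.exp (-Real.pi * n) * besselKernel (Real.pi / 2) x := by
    rw [besselKernel, ← Real.exp_add]
    refine Real.exp_le_exp.2 ?_
    have h3 := two_le_add_inv hx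
    have h4 : 0 ≤ (n - 1 : ℝ) * (x + x⁻¹ - 2) := mul_nonneg (by linarith) (by linarith)
    nlinarith
  have hre : (s - 3 / 2).re = s.re - 3 / 2 := by simp
  have hpow : x ^ (s.re - 3 / 2) ≤ x ^ (R - 3 / 2) + x ^ (-R - 3 / 2) := by
    rcases le_total 1 x with h | h
    · exact (Real.rpow_le_rpow_of_exponent_le h (by linarith)).trans
        (le_add_of_nonneg_right (by positivity))
    · exact (Real.rpow_le_rpow_of_exponent_ge hx h (by linarith)).trans
        (le_add_of_nonneg_left (by positivity))
  rw [besselIntegrand, norm_mul, Complex.norm_cpow_eq_rpow_re_of_pos hx, hre, Complex.norm_real,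
    Real.norm_of_nonneg (Real.exp_pos _).le]
  refine (mul_le_mul hpow hexp (Real.exp_pos _).le (by positivity)).trans_eq ?_
  ring

/-- The bound for the Bessel integrals in the strip `|Re s| ≤ R`. -/
noncomputable def besselBound (R : ℝ) : ℝ :=
  ∫ x in Ioi (0 : ℝ), (x ^ (R - 3 / 2) * besselKernel (Real.pi / 2) x +
    x ^ (-R - 3 / 2) * besselKernel (Real.pi / 2) x)

theorem norm_integral_besselIntegrand_le {s : ℂ} {R : ℝ} (h1 : -R ≤ s.re) (h2 : s.re ≤ R) (n : ℕ+) :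
    ‖∫ x in Ioi (0 : ℝ), besselIntegrand s n x‖ ≤ Real.exp (-Real.pi * n) * besselBound R := by
  have hπ : 0 < Real.pi / 2 := by positivity
  rw [besselBound, ← integral_const_mul]
  refine norm_integral_le_of_norm_le
    (((integrableOn_rpow_mul_besselKernel hπ _).add
      (integrableOn_rpow_mul_besselKernel hπ _)).const_mul _) ?_
  exact (ae_restrict_iff' measurableSet_Ioi).2
    (.of_forall fun x hx => norm_besselIntegrand_le h1 h2 n hx)

/-- The exponent collects `R` from the power of `n`, `2R + 1` from each divisor power, and one more
from the number of divisors, which is at most `n`. -/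
theorem norm_divisorTerm_le {s : ℂ} {R : ℕ} (h1 : -(R : ℝ) ≤ s.re) (h2 : s.re ≤ R) (n : ℕ+) :
    ‖divisorTerm s n‖ ≤ (n : ℝ) ^ (3 * R + 2) * Real.exp (-Real.pi * n) * besselBound R := by
  have hn : (1 : ℝ) ≤ n := by exact_mod_cast n.2
  have hn0 : (0 : ℝ) < n := by linarith
  have e1 : ‖((n : ℕ) : ℂ) ^ (s - 1 / 2)‖ ≤ (n : ℝ) ^ R := by
    rw [Complex.norm_natCast_cpow_of_pos n.pos, ← Real.rpow_natCast]
    refine Real.rpow_le_rpow_of_exponent_le hn ?_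
    simp only [Complex.sub_re, Complex.one_re, Complex.div_ofNat_re]
    linarith
  have e2 : ‖∑ d ∈ (n : ℕ).divisors, (d : ℂ) ^ (1 - 2 * s)‖ ≤ (n : ℝ) ^ (2 * R + 2) := by
    refine (norm_sum_le_of_le (f := fun d : ℕ => (d : ℂ) ^ (1 - 2 * s)) _
      (n := fun _ => (n : ℝ) ^ (2 * R + 1)) fun d hd => ?_).trans ?_
    · have hd0 := Nat.pos_of_mem_divisors hd
      have hdn : (d : ℝ) ≤ n := by exact_mod_cast Nat.divisor_le hd
      have hd1 : (1 : ℝ) ≤ d := by exact_mod_cast hd0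
      rw [Complex.norm_natCast_cpow_of_pos hd0]
      refine le_trans (Real.rpow_le_rpow_of_exponent_le hd1 (z := ((2 * R + 1 : ℕ) : ℝ)) ?_) ?_
      · simp only [Complex.sub_re, Complex.one_re, Complex.mul_re, Complex.re_ofNat,
          Complex.im_ofNat, zero_mul, sub_zero]
        push_cast
        linarith
      · rw [Real.rpow_natCast]
        gcongr
    · rw [Finset.sum_const, nsmul_eq_mul, pow_succ _ (2 * R + 1), mul_comm]
      refine mul_le_mul_of_nonneg_left ?_ (by positivity)
      exact_mod_cast Nat.card_divisors_le_self n
  rw [divisorTerm, norm_mul, norm_mul]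
  calc _ ≤ (n : ℝ) ^ R * (n : ℝ) ^ (2 * R + 2) * (Real.exp (-Real.pi * n) * besselBound R) := by
        gcongr
        exact norm_integral_besselIntegrand_le h1 h2 n
    _ = _ := by ring

theorem summable_divisorTerm_bound (R : ℕ) : Summable fun n : ℕ+ =>
    (n : ℝ) ^ (3 * R + 2) * Real.exp (-Real.pi * n) * besselBound R :=
  ((Real.summable_pow_mul_exp_neg_nat_mul (3 * R + 2) Real.pi_pos).comp_injective
    PNat.coe_injective).mul_right _

theorem exists_nat_bounds_re (s : ℂ) : ∃ R : ℕ, -(R : ℝ) < s.re ∧ s.re < R := by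
  obtain ⟨R, hR⟩ := exists_nat_gt |s.re|
  exact ⟨R, abs_lt.1 hR⟩

theorem summable_divisorTerm (s : ℂ) : Summable (divisorTerm s) := by
  obtain ⟨R, h1, h2⟩ := exists_nat_bounds_re s
  exact (summable_divisorTerm_bound R).of_norm_bounded (norm_divisorTerm_le h1.le h2.le)

theorem differentiable_divisorTerm (n : ℕ+) : Differentiable ℂ fun s => divisorTerm s n := by
  have hn : ((n : ℕ) : ℂ) ≠ 0 := by exact_mod_cast n.ne_zero
  have h1 : Differentiable ℂ fun s : ℂ => ((n : ℕ) : ℂ) ^ (s - 1 / 2) := fun s =>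
    (differentiableAt_id.sub_const _).const_cpow (Or.inl hn)
  have h2 : Differentiable ℂ fun s : ℂ => ∑ d ∈ (n : ℕ).divisors, (d : ℂ) ^ (1 - 2 * s) := fun s =>
    DifferentiableAt.fun_sum fun d hd => ((differentiableAt_id.const_mul 2).const_sub 1).const_cpow
      (Or.inl (by exact_mod_cast (Nat.pos_of_mem_divisors hd).ne'))
  have h3 : Differentiable ℂ fun s : ℂ => ∫ x in Ioi (0 : ℝ), besselIntegrand s n x := by
    simp only [integral_besselIntegrand]
    exact (differentiable_mellin_besselKernel (by positivity)).comp (differentiable_id.sub_const _)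
  exact (h1.mul h2).mul h3

/-- The bound on `divisorTerm` is uniform on the strip `|Re s| ≤ R`, and every point lies in the
interior of such a strip. -/
theorem differentiable_tsum_divisorTerm : Differentiable ℂ fun s => ∑' n : ℕ+, divisorTerm s n := by
  intro s
  obtain ⟨R, h1, h2⟩ := exists_nat_bounds_re s
  have ho : IsOpen {z : ℂ | -(R : ℝ) < z.re ∧ z.re < R} :=
    (isOpen_lt continuous_const Complex.continuous_re).inter
      (isOpen_lt Complex.continuous_re continuous_const)
  exact (Complex.differentiableOn_tsum_of_summable_norm (summable_divisorTerm_bound R)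
    (fun n => (differentiable_divisorTerm n).differentiableOn) ho
    fun n z hz => norm_divisorTerm_le hz.1.le hz.2.le n).differentiableAt (ho.mem_nhds ⟨h1, h2⟩)

theorem meromorphicAt_riemannZeta (s : ℂ) : MeromorphicAt riemannZeta s := by
  have h1 : MeromorphicAt (fun z : ℂ => (completedRiemannZeta₀ z - 1 / z - 1 / (1 - z)) *
      (Complex.Gammaℝ z)⁻¹) s :=
    ((((differentiable_completedZeta₀.analyticAt s).meromorphicAt).sub
      ((MeromorphicAt.const 1 s).div (MeromorphicAt.id s))).sub ((MeromorphicAt.const 1 s).div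
        ((MeromorphicAt.const 1 s).sub (MeromorphicAt.id s)))).mul
      (Complex.differentiable_Gammaℝ_inv.analyticAt s).meromorphicAt
  refine h1.congr ?_
  have h0 : ∀ᶠ z in 𝓝[≠] s, z ≠ 0 := by
    rcases eq_or_ne s 0 with rfl | hs
    · exact self_mem_nhdsWithin
    · exact nhdsWithin_le_nhds (isOpen_ne.mem_nhds hs)
  filter_upwards [h0] with z hz
  rw [riemannZeta_def_of_ne_zero hz, completedRiemannZeta_eq,
    div_eq_mul_inv _ (Complex.Gammaℝ z)]

theorem meromorphicAt_Gamma (s : ℂ) : MeromorphicAt Complex.Gamma s := by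
  have := ((Complex.differentiable_one_div_Gamma.analyticAt s).meromorphicAt).inv
  refine this.congr (.of_forall fun z => ?_)
  simp

theorem meromorphicOn_chowlaSelbergExpr {a : ℝ} (ha : 0 < a) :
    MeromorphicOn (chowlaSelbergExpr a) univ := by
  intro s _
  have hd : ∀ {f : ℂ → ℂ}, Differentiable ℂ f → MeromorphicAt f s := fun hf =>
    (hf.analyticAt s).meromorphicAt
  have hpow : ∀ {b : ℂ}, b ≠ 0 → ∀ {f : ℂ → ℂ}, Differentiable ℂ f →
      MeromorphicAt (fun s => b ^ f s) s := fun hb f hf =>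
    hd fun s => (hf s).const_cpow (Or.inl hb)
  have hcomp : ∀ {F f : ℂ → ℂ}, (∀ z, MeromorphicAt F z) → Differentiable ℂ f →
      MeromorphicAt (fun s => F (f s)) s := fun hF hf =>
    (hF _).comp_analyticAt (hf.analyticAt s)
  have hπ := Real.pi_pos
  have b1 : ((a / Real.pi : ℝ) : ℂ) ≠ 0 := Complex.ofReal_ne_zero.2 (by positivity)
  have b2 : ((a ^ 2 / Real.pi : ℝ) : ℂ) ≠ 0 := Complex.ofReal_ne_zero.2 (by positivity)
  have l1 : Differentiable ℂ fun s : ℂ => 2 * s := by fun_prop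
  have l2 : Differentiable ℂ fun s : ℂ => 2 * s - 1 := by fun_prop
  have l3 : Differentiable ℂ fun s : ℂ => s - 1 / 2 := by fun_prop
  have l4 : Differentiable ℂ fun s : ℂ => s + 1 := by fun_prop
  have c : ∀ z : ℂ, MeromorphicAt (fun _ : ℂ => z) s := fun z => MeromorphicAt.const z s
  have z1 := hcomp meromorphicAt_riemannZeta l1
  have z2 := hcomp meromorphicAt_riemannZeta l2
  have g1 := hcomp meromorphicAt_Gamma l3
  have g2 := meromorphicAt_Gamma s
  have p1 := hpow b1 l1
  exact (((((c _).mul p1).mul z1).sub ((((c 1).div (hpow two_ne_zero l4)).mul p1).mul z1)).add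
    (((c _).mul p1).mul ((z2.mul g1).div g2))).add
    ((((c _).mul (hpow b2 differentiable_id)).mul ((c 1).div g2)).mul
      (hd differentiable_tsum_divisorTerm))

end BesselIntegrals

/-! ### The Chowla–Selberg formula via theta functions. -/

section ChowlaSelberg

open Filter Topology

/-- The tail `∑_{n ≥ 1} exp (-π n² t)` of the Jacobi theta function. -/
noncomputable def thetaTail (t : ℝ) : ℝ := (HurwitzZeta.cosKernel 0 t - 1) / 2

theorem hasSum_thetaTail {t : ℝ} (ht : 0 < t) :
    HasSum (fun n : ℕ+ => Real.exp (-Real.pi * (n : ℝ) ^ 2 * t)) (thetaTail t) := by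
  have h := (HurwitzZeta.hasSum_nat_cosKernel₀ 0 ht).div_const 2
  rw [QuotientAddGroup.mk_zero] at h
  rw [← Equiv.pnatEquivNat.symm.hasSum_iff, thetaTail]
  convert! h using 2 with n
  simp

theorem continuousOn_thetaTail : ContinuousOn thetaTail (Ioi 0) :=
  ((HurwitzZeta.continuousOn_cosKernel 0).sub continuousOn_const).div_const 2

/-- Jacobi's inversion `θ(t) = t^(-1/2) θ(1/t)`, rewritten for the tail through `θ = 1 + 2ω`. -/
theorem thetaTail_eq {t : ℝ} (ht : 0 < t) :
    thetaTail t = t ^ (-(1 / 2) : ℝ) * thetaTail t⁻¹ + t ^ (-(1 / 2) : ℝ) / 2 - 1 / 2 := by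
  have h := HurwitzZeta.evenKernel_functional_equation 0 t
  rw [HurwitzZeta.evenKernel_eq_cosKernel_of_zero, one_div, one_div t, ← Real.rpow_neg ht.le] at h
  rw [thetaTail, h, thetaTail]
  ring

theorem isBigO_thetaTail_atTop (b : ℝ) : thetaTail =O[atTop] fun t : ℝ => t ^ b := by
  obtain ⟨p, hp, h⟩ := HurwitzZeta.isBigO_atTop_cosKernel_sub 0
  have h2 := (h.trans (isLittleO_exp_neg_mul_rpow_atTop hp b).isBigO).const_mul_left (1 / 2)
  refine h2.congr_left fun t => ?_
  rw [thetaTail]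
  ring

theorem isBigO_thetaTail_zero : thetaTail =O[𝓝[>] 0] fun t : ℝ => t ^ (-(1 / 2) : ℝ) := by
  have h0 := (isBigO_thetaTail_atTop 0).comp_tendsto tendsto_inv_nhdsGT_zero
  have h1 : (fun t : ℝ => thetaTail t⁻¹) =O[𝓝[>] 0] fun _ => (1 : ℝ) :=
    h0.congr (fun _ => rfl) fun t => by simp
  have h2 : (fun t : ℝ => t ^ (-(1 / 2) : ℝ) * thetaTail t⁻¹) =O[𝓝[>] 0]
      fun t : ℝ => t ^ (-(1 / 2) : ℝ) := by
    simpa using (Asymptotics.isBigO_refl (fun t : ℝ => t ^ (-(1 / 2) : ℝ)) (𝓝[>] 0)).mul h1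
  have h3 : (fun t : ℝ => t ^ (-(1 / 2) : ℝ) / 2) =O[𝓝[>] 0]
      fun t : ℝ => t ^ (-(1 / 2) : ℝ) := by
    simpa [div_eq_inv_mul] using (Asymptotics.isBigO_refl
      (fun t : ℝ => t ^ (-(1 / 2) : ℝ)) (𝓝[>] 0)).const_mul_left (1 / 2)
  have h4 : (fun _ : ℝ => (1 / 2 : ℝ)) =O[𝓝[>] 0] fun t : ℝ => t ^ (-(1 / 2) : ℝ) := by
    refine Asymptotics.IsBigO.of_bound 1 ?_
    filter_upwards [Ioo_mem_nhdsGT (zero_lt_one : (0 : ℝ) < 1)] with t ht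
    rw [one_mul, Real.norm_of_nonneg (by norm_num), Real.norm_of_nonneg (Real.rpow_nonneg ht.1.le _)]
    refine le_trans (by norm_num) (Real.one_le_rpow_of_pos_of_le_one_of_nonpos ht.1 ht.2.le ?_)
    norm_num
  refine ((h2.add h3).sub h4).congr' ?_ EventuallyEq.rfl
  filter_upwards [self_mem_nhdsWithin] with t ht
  exact (thetaTail_eq ht).symm

theorem isBigO_thetaTail_inv_atTop :
    (fun t => thetaTail t⁻¹) =O[atTop] fun t : ℝ => t ^ (1 / 2 : ℝ) := by
  refine (isBigO_thetaTail_zero.comp_tendsto tendsto_inv_atTop_nhdsGT_zero).congr' ?_ ?_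
  · exact .of_forall fun t => rfl
  · filter_upwards [eventually_gt_atTop 0] with t ht
    rw [Function.comp_apply, Real.rpow_neg (inv_nonneg.2 ht.le), Real.inv_rpow ht.le, inv_inv]

theorem isBigO_thetaTail_inv_zero :
    (fun t => thetaTail t⁻¹) =O[𝓝[>] 0] fun _ : ℝ => (1 : ℝ) :=
  ((isBigO_thetaTail_atTop 0).comp_tendsto tendsto_inv_nhdsGT_zero).congr (fun _ => rfl)
    fun t => by simp

theorem mellinConvergent_thetaTail {s : ℂ} (hs : 1 / 2 < s.re) :
    MellinConvergent (fun t => (thetaTail t : ℂ)) s :=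
  mellinConvergent_of_isBigO_rpow (a := s.re + 1) (b := 1 / 2)
    ((Complex.continuous_ofReal.comp_continuousOn
      continuousOn_thetaTail).locallyIntegrableOn measurableSet_Ioi)
    (Complex.isBigO_ofReal_left.2 (isBigO_thetaTail_atTop _)) (by linarith)
    (Complex.isBigO_ofReal_left.2 isBigO_thetaTail_zero) hs

theorem mellinConvergent_thetaTail_mul_inv {s : ℂ} (hs : 1 / 2 < s.re) :
    MellinConvergent (fun t => ((thetaTail t * thetaTail t⁻¹ : ℝ) : ℂ)) s := by
  have hc : ContinuousOn (fun t => thetaTail t * thetaTail t⁻¹) (Ioi 0) :=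
    continuousOn_thetaTail.mul (continuousOn_thetaTail.comp
      (continuousOn_id.inv₀ fun x hx => (mem_Ioi.1 hx).ne') fun x hx => inv_pos.2 (mem_Ioi.1 hx))
  refine mellinConvergent_of_isBigO_rpow (a := s.re + 1) (b := 1 / 2)
    ((Complex.continuous_ofReal.comp_continuousOn hc).locallyIntegrableOn measurableSet_Ioi)
    (Complex.isBigO_ofReal_left.2 ?_) (by linarith) (Complex.isBigO_ofReal_left.2 ?_) hs
  · refine ((isBigO_thetaTail_atTop (-(s.re + 1) - 1 / 2)).mul isBigO_thetaTail_inv_atTop).congr'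
      EventuallyEq.rfl ?_
    filter_upwards [eventually_gt_atTop 0] with t ht
    rw [← Real.rpow_add ht]
    ring_nf
  · simpa using isBigO_thetaTail_zero.mul isBigO_thetaTail_inv_zero

theorem mellin_thetaTail {s : ℂ} (hs : 1 / 2 < s.re) : mellin (fun t => (thetaTail t : ℂ)) s =
    (Real.pi : ℂ) ^ (-s) * Complex.Gamma s * riemannZeta (2 * s) := by
  have h2 : 1 < (2 * s).re := by
    simp only [Complex.mul_re, Complex.re_ofNat, Complex.im_ofNat, zero_mul, sub_zero]
    linarith
  have hsq : ∀ n : ℕ+, (((n : ℝ) ^ 2 : ℝ) : ℂ) ^ s = ((n : ℕ) : ℂ) ^ (2 * s) := fun n => by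
    rw [← ofReal_cpow_two_mul (by exact_mod_cast n.pos), Complex.ofReal_natCast]
  have h := hasSum_mellin_pi_mul (ι := ℕ+) (a := fun _ => 1) (q := fun n => (n : ℝ) ^ 2)
    (F := fun t => (thetaTail t : ℂ)) (s := s) (fun n => Or.inr (by positivity)) (by linarith)
    (fun t ht => by simpa using Complex.hasSum_ofReal.2 (hasSum_thetaTail ht)) ?_
  · rw [← h.tsum_eq, zeta_eq_tsum_one_div_nat_add_one_cpow h2, ← tsum_mul_left,
      tsum_congr fun n => by rw [hsq n],
      tsum_pnat_eq_tsum_succ (f := fun n : ℕ => (Real.pi : ℂ) ^ (-s) * Complex.Gamma s * 1 /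
        (n : ℂ) ^ (2 * s))]
    exact tsum_congr fun n => by push_cast; ring
  · have hsum := (Real.summable_one_div_nat_rpow (p := 2 * s.re)).2 (by linarith)
    refine (hsum.comp_injective PNat.coe_injective).congr fun n => ?_
    rw [Function.comp_apply, norm_one, Real.rpow_mul (by positivity), Real.rpow_two]

theorem mellin_thetaTail_sq {s : ℂ} (hs : 1 < s.re) :
    mellin (fun t => ((thetaTail t * thetaTail t : ℝ) : ℂ)) s =
      (Real.pi : ℂ) ^ (-s) * Complex.Gamma s * quadrantSum s := by
  have h := hasSum_mellin_pi_mul (ι := ℕ+ × ℕ+) (a := fun _ => 1)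
    (q := fun p => (p.1 : ℝ) ^ 2 + (p.2 : ℝ) ^ 2)
    (F := fun t => ((thetaTail t * thetaTail t : ℝ) : ℂ)) (s := s)
    (fun n => Or.inr (by positivity)) (by linarith) (fun t ht => ?_) ?_
  · rw [← h.tsum_eq, quadrantSum, ← tsum_mul_left]
    refine tsum_congr fun p => ?_
    simp only [sumSqTerm, Complex.cpow_neg _ s]
    push_cast
    ring
  · have h1 := hasSum_thetaTail ht
    have h2 := h1.summable.mul_of_nonneg h1.summable (fun _ => (Real.exp_pos _).le)
      fun _ => (Real.exp_pos _).le
    have h3 := Complex.hasSum_ofReal.2 (h1.mul h1 h2)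
    convert! h3 using 2 with p
    rw [one_mul, ← Real.exp_add]
    congr 2
    ring
  · refine (summable_quadrant hs).norm.congr fun p => ?_
    have hp : (0 : ℝ) < ((p.1 : ℕ) : ℝ) ^ 2 + ((p.2 : ℕ) : ℝ) ^ 2 := by positivity
    rw [sumSqTerm]
    simp only [Int.cast_natCast]
    rw [Complex.norm_cpow_eq_rpow_re_of_pos hp, Complex.neg_re, Real.rpow_neg hp.le]
    simp

/-- Inversion is applied to one factor of `ω²` only. The factor `t^(-1/2)` shifts the Mellin
argument to `s - 1/2`; the shifted integral of `ω` needs `Re s - 1/2 > 1/2`, which is the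
hypothesis. -/
theorem mellin_thetaTail_sq_eq {s : ℂ} (hs : 1 < s.re) :
    mellin (fun t => ((thetaTail t * thetaTail t : ℝ) : ℂ)) s =
      mellin (fun t => ((thetaTail t * thetaTail t⁻¹ : ℝ) : ℂ)) (s - 1 / 2) +
      (1 / 2) * mellin (fun t => (thetaTail t : ℂ)) (s - 1 / 2) -
      (1 / 2) * mellin (fun t => (thetaTail t : ℂ)) s := by
  have hre : 1 / 2 < (s - 1 / 2).re := by
    simp only [Complex.sub_re, Complex.div_ofNat_re, Complex.one_re]
    linarith
  have i1 := mellinConvergent_thetaTail_mul_inv hre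
  have i2 := mellinConvergent_thetaTail hre
  have i3 := mellinConvergent_thetaTail (s := s) (by linarith)
  have key : ∀ {f g k : ℝ → ℂ}, IntegrableOn f (Ioi 0) → IntegrableOn g (Ioi 0) →
      IntegrableOn k (Ioi 0) → ∫ t in Ioi (0 : ℝ), (f t + 1 / 2 * g t - 1 / 2 * k t) =
        (∫ t in Ioi (0 : ℝ), f t) + 1 / 2 * (∫ t in Ioi (0 : ℝ), g t) -
          1 / 2 * ∫ t in Ioi (0 : ℝ), k t := fun hf hg hk => by
    rw [← integral_const_mul, ← integral_const_mul, ← integral_add hf (hg.const_mul _)]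
    exact integral_sub (hf.add (hg.const_mul _)) (hk.const_mul _)
  rw [mellin, mellin, mellin, mellin, ← key i1 i2 i3]
  refine setIntegral_congr_fun measurableSet_Ioi fun t ht => ?_
  have ht0 : (0 : ℝ) < t := ht
  have e : (t : ℂ) ^ (s - 1 / 2 - 1) = (t : ℂ) ^ (s - 1) * ((t ^ (-(1 / 2) : ℝ) : ℝ) : ℂ) := by
    rw [Complex.ofReal_cpow ht0.le, ← Complex.cpow_add _ _ (Complex.ofReal_ne_zero.2 ht0.ne')]
    congr 1
    push_cast
    ring
  have hFE := congrArg (fun x : ℝ => (x : ℂ)) (thetaTail_eq ht0)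
  simp only [smul_eq_mul, e]
  push_cast at hFE ⊢
  linear_combination (t : ℂ) ^ (s - 1) * (thetaTail t : ℂ) * hFE

theorem summable_exp_neg_mul_pnat_prod : Summable fun p : ℕ+ × ℕ+ =>
    Real.exp (-Real.pi * ((p.1 : ℝ) * p.2)) := by
  have h1 : Summable fun n : ℕ+ => Real.exp (-(Real.pi / 2) * n) := by
    have h := Real.summable_pow_mul_exp_neg_nat_mul 0 (half_pos Real.pi_pos)
    refine (h.comp_injective PNat.coe_injective).congr fun n => ?_
    simp
  refine (h1.mul_of_nonneg h1 (fun _ => (Real.exp_pos _).le)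
    fun _ => (Real.exp_pos _).le).of_nonneg_of_le (fun _ => (Real.exp_pos _).le) fun p => ?_
  rw [← Real.exp_add]
  refine Real.exp_le_exp.2 ?_
  have hm : (1 : ℝ) ≤ p.1 := by exact_mod_cast p.1.2
  have hn : (1 : ℝ) ≤ p.2 := by exact_mod_cast p.2.2
  have hp := Real.pi_pos
  nlinarith [mul_nonneg (sub_nonneg.2 hm) (sub_nonneg.2 hn)]

/-- The product of two theta terms as a rescaled Bessel kernel. -/
theorem exp_mul_exp_eq_besselKernel (m n : ℕ+) {t : ℝ} (ht : 0 < t) :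
    Real.exp (-Real.pi * (m : ℝ) ^ 2 * t) * Real.exp (-Real.pi * (n : ℝ) ^ 2 * t⁻¹) =
      besselKernel (Real.pi * ((m * n : ℕ+) : ℕ)) ((m : ℝ) / n * t) := by
  have hm : (0 : ℝ) < m := by exact_mod_cast m.pos
  have hn : (0 : ℝ) < n := by exact_mod_cast n.pos
  rw [besselKernel, ← Real.exp_add]
  congr 1
  push_cast
  field_simp
  ring

/-- Expand both theta factors, integrate term by term and substitute `x = (m/n)t` in the term of
`(m, n)`. The exchange is justified for every `s`. -/
theorem hasSum_mellin_thetaTail_mul_inv (s : ℂ) : HasSum (fun p : ℕ+ × ℕ+ =>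
      (((p.1 : ℝ) / p.2 : ℝ) : ℂ) ^ (-(s - 1 / 2)) *
        ∫ x in Ioi (0 : ℝ), besselIntegrand s (p.1 * p.2) x)
    (mellin (fun t => ((thetaTail t * thetaTail t⁻¹ : ℝ) : ℂ)) (s - 1 / 2)) := by
  have hπ := Real.pi_pos
  let F : ℕ+ × ℕ+ → ℝ → ℂ := fun p t => (t : ℂ) ^ (s - 1 / 2 - 1) •
    ((besselKernel (Real.pi * ((p.1 * p.2 : ℕ+) : ℕ)) ((p.1 : ℝ) / p.2 * t) : ℝ) : ℂ)
  have hpos : ∀ p : ℕ+ × ℕ+, (0 : ℝ) < (p.1 : ℝ) / p.2 := fun p => by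
    have hm : (0 : ℝ) < p.1 := by exact_mod_cast p.1.pos
    have hn : (0 : ℝ) < p.2 := by exact_mod_cast p.2.pos
    positivity
  have hFint : ∀ p, Integrable (F p) (volume.restrict (Ioi 0)) := fun p => by
    have h := mellinConvergent_besselKernel (c := Real.pi * ((p.1 * p.2 : ℕ+) : ℕ))
      (by positivity) (s - 1 / 2)
    exact (MellinConvergent.comp_mul_left (hpos p)).2 h
  have hFval : ∀ p, ∫ t in Ioi (0 : ℝ), F p t = (((p.1 : ℝ) / p.2 : ℝ) : ℂ) ^ (-(s - 1 / 2)) *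
        ∫ x in Ioi (0 : ℝ), besselIntegrand s (p.1 * p.2) x := fun p => by
    rw [integral_besselIntegrand, ← smul_eq_mul, ← mellin_comp_mul_left _ _ (hpos p), mellin]
  have hFbound : ∀ p, ∀ t ∈ Ioi (0 : ℝ), ‖F p t‖ ≤ Real.exp (-Real.pi * ((p.1 : ℝ) * p.2)) *
      (t ^ (s.re - 3 / 2) * besselKernel (Real.pi / 2) t) := fun p t ht => by
    have ht0 : (0 : ℝ) < t := ht
    have hm : (1 : ℝ) ≤ p.1 := by exact_mod_cast p.1.2
    have hn : (1 : ℝ) ≤ p.2 := by exact_mod_cast p.2.2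
    have hre : (s - 1 / 2 - 1).re = s.re - 3 / 2 := by
      simp only [Complex.sub_re, Complex.div_ofNat_re, Complex.one_re]
      ring
    rw [norm_smul, Complex.norm_cpow_eq_rpow_re_of_pos ht0, hre, Complex.norm_real,
      Real.norm_of_nonneg (besselKernel_pos _ _).le, mul_left_comm]
    refine mul_le_mul_of_nonneg_left ?_ (by positivity)
    rw [← exp_mul_exp_eq_besselKernel _ _ ht0, besselKernel, ← Real.exp_add, ← Real.exp_add]
    refine Real.exp_le_exp.2 ?_
    -- Half of the exponent is spent on this AM–GM bound, giving `exp(-πmn)`, and the other half on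
    -- `h2`, giving a fixed integrable kernel.
    have h1 : 2 * ((p.1 : ℝ) * p.2) ≤ (p.1 : ℝ) ^ 2 * t + (p.2 : ℝ) ^ 2 * t⁻¹ := by
      have : (p.1 : ℝ) ^ 2 * t + (p.2 : ℝ) ^ 2 * t⁻¹ - 2 * ((p.1 : ℝ) * p.2) =
          ((p.1 : ℝ) * t - p.2) ^ 2 / t := by
        field_simp
        ring
      have h2 : 0 ≤ ((p.1 : ℝ) * t - p.2) ^ 2 / t := by positivity
      linarith
    have h2 : t + t⁻¹ ≤ (p.1 : ℝ) ^ 2 * t + (p.2 : ℝ) ^ 2 * t⁻¹ := by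
      have h3 := one_le_pow₀ (n := 2) hm
      have h4 := one_le_pow₀ (n := 2) hn
      have h5 : 0 < t⁻¹ := by positivity
      nlinarith
    nlinarith
  have hFsum : Summable fun p => ∫ t in Ioi (0 : ℝ), ‖F p t‖ := by
    have hJ := integrableOn_rpow_mul_besselKernel (half_pos hπ) (s.re - 3 / 2)
    refine (summable_exp_neg_mul_pnat_prod.mul_right
      (∫ t in Ioi (0 : ℝ), t ^ (s.re - 3 / 2) * besselKernel (Real.pi / 2) t)).of_nonneg_of_le
      (fun p => integral_nonneg fun _ => norm_nonneg _) fun p => ?_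
    rw [← integral_const_mul]
    exact setIntegral_mono_on (hFint p).norm (hJ.const_mul _) measurableSet_Ioi (hFbound p)
  have h := hasSum_integral_of_summable_integral_norm hFint hFsum
  simp only [hFval] at h
  suffices he : mellin (fun t => ((thetaTail t * thetaTail t⁻¹ : ℝ) : ℂ)) (s - 1 / 2) =
      ∫ t in Ioi (0 : ℝ), ∑' p, F p t by
    rw [he]
    exact h
  refine setIntegral_congr_fun measurableSet_Ioi fun t ht => ?_
  have h1 := hasSum_thetaTail ht
  have h2 := hasSum_thetaTail (inv_pos.2 (mem_Ioi.1 ht))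
  have h3 := Complex.hasSum_ofReal.2 (h1.mul h2 (h1.summable.mul_of_nonneg h2.summable
    (fun _ => (Real.exp_pos _).le) fun _ => (Real.exp_pos _).le))
  simp only [exp_mul_exp_eq_besselKernel _ _ (mem_Ioi.1 ht)] at h3
  exact (h3.const_smul ((t : ℂ) ^ (s - 1 / 2 - 1))).tsum_eq.symm

/-- Group the pairs by `N = mn`. Since `m/n = m²/N`, the scaling factor becomes `N^(s - 1/2) m^(1 -
2s)`, while the Bessel integral depends only on `N`. -/
theorem hasSum_divisorTerm (s : ℂ) : HasSum (divisorTerm s)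
    (mellin (fun t => ((thetaTail t * thetaTail t⁻¹ : ℝ) : ℂ)) (s - 1 / 2)) := by
  have h := hasSum_mellin_thetaTail_mul_inv s
  rw [← sigmaAntidiagonalEquivProd.hasSum_iff] at h
  refine h.sigma fun N => ?_
  have hterm : ∀ p : Nat.divisorsAntidiagonal N,
      ((fun p : ℕ+ × ℕ+ => (((p.1 : ℝ) / p.2 : ℝ) : ℂ) ^ (-(s - 1 / 2)) *
        ∫ x in Ioi (0 : ℝ), besselIntegrand s (p.1 * p.2) x) ∘ sigmaAntidiagonalEquivProd) ⟨N, p⟩ =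
      ((N : ℕ) : ℂ) ^ (s - 1 / 2) * (p.1.1 : ℂ) ^ (1 - 2 * s) *
        ∫ x in Ioi (0 : ℝ), besselIntegrand s N x := fun p => by
    have hmul := (Nat.mem_divisorsAntidiagonal.1 p.2).1
    have hN : (sigmaAntidiagonalEquivProd ⟨N, p⟩).1 * (sigmaAntidiagonalEquivProd ⟨N, p⟩).2 = N :=
      PNat.eq hmul
    rw [Function.comp_apply, hN]
    congr 1
    change (((p.1.1 : ℝ) / (p.1.2 : ℝ) : ℝ) : ℂ) ^ (-(s - 1 / 2)) = _
    have hN0 := N.pos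
    rw [← hmul] at hN0
    have hm : (0 : ℝ) < (p.1.1 : ℝ) := by exact_mod_cast Nat.pos_of_mul_pos_right hN0
    have hn : (0 : ℝ) < (p.1.2 : ℝ) := by exact_mod_cast Nat.pos_of_mul_pos_left hN0
    have hdiv : (p.1.1 : ℝ) / (p.1.2 : ℝ) = (p.1.1 : ℝ) ^ 2 * ((N : ℕ) : ℝ)⁻¹ := by
      have hmul' : (p.1.1 : ℝ) * (p.1.2 : ℝ) = ((N : ℕ) : ℝ) := by exact_mod_cast hmul
      rw [← hmul']
      field_simp
    rw [hdiv, Complex.ofReal_mul, Complex.mul_cpow_ofReal_nonneg (by positivity) (by positivity),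
      ← ofReal_cpow_two_mul hm, Complex.ofReal_inv, Complex.ofReal_natCast, Complex.ofReal_natCast,
      Complex.inv_cpow _ _ (by rw [Complex.natCast_arg]; exact Real.pi_pos.ne), Complex.cpow_neg,
      inv_inv, mul_comm]
    congr 2
    ring
  simp only [hterm]
  have hsum := Finset.hasSum (Nat.divisorsAntidiagonal N) fun p : ℕ × ℕ =>
    ((N : ℕ) : ℂ) ^ (s - 1 / 2) * (p.1 : ℂ) ^ (1 - 2 * s) *
      ∫ x in Ioi (0 : ℝ), besselIntegrand s N x
  rw [Nat.sum_divisorsAntidiagonal (fun i _ => ((N : ℕ) : ℂ) ^ (s - 1 / 2) *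
    (i : ℂ) ^ (1 - 2 * s) * ∫ x in Ioi (0 : ℝ), besselIntegrand s N x), ← Finset.sum_mul,
    ← Finset.mul_sum] at hsum
  exact hsum

/-- The Chowla–Selberg formula for the sum of two squares. -/
theorem Gamma_mul_quadrantSum {s : ℂ} (hs : 1 < s.re) :
    (Real.pi : ℂ) ^ (-s) * Complex.Gamma s * quadrantSum s = ∑' n : ℕ+, divisorTerm s n +
      1 / 2 * ((Real.pi : ℂ) ^ (-(s - 1 / 2)) * Complex.Gamma (s - 1 / 2) *
        riemannZeta (2 * s - 1)) -
      1 / 2 * ((Real.pi : ℂ) ^ (-s) * Complex.Gamma s * riemannZeta (2 * s)) := by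
  have hre : 1 / 2 < (s - 1 / 2).re := by
    simp only [Complex.sub_re, Complex.div_ofNat_re, Complex.one_re]
    linarith
  rw [← mellin_thetaTail_sq hs, mellin_thetaTail_sq_eq hs, mellin_thetaTail hre,
    mellin_thetaTail (by linarith), (hasSum_divisorTerm s).tsum_eq,
    show 2 * (s - 1 / 2) = 2 * s - 1 by ring]

end ChowlaSelberg

/-! ### Matching the constants of the two formulas. -/

section Assembly

theorem ofReal_div_cpow {x y : ℝ} (hx : 0 < x) (hy : 0 < y) (s : ℂ) :
    ((x / y : ℝ) : ℂ) ^ s = (x : ℂ) ^ s / (y : ℂ) ^ s := by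
  rw [eq_div_iff (by simp [Complex.cpow_eq_zero_iff, hy.ne']),
    ← Complex.mul_cpow_ofReal_nonneg (by positivity) hy.le, ← Complex.ofReal_mul,
    div_mul_cancel₀ _ hy.ne']

variable {a : ℝ} {s : ℂ}

theorem ofReal_cpow_ne_zero {x : ℝ} (hx : 0 < x) (s : ℂ) : (x : ℂ) ^ s ≠ 0 := by
  simp [Complex.cpow_eq_zero_iff, hx.ne']

theorem eigenvalue_scale_cpow (ha : 0 < a) (s : ℂ) :
    (((Real.pi / a) ^ 2 : ℝ) : ℂ) ^ (-s) = (a : ℂ) ^ (2 * s) / (Real.pi : ℂ) ^ (2 * s) := by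
  rw [Complex.cpow_neg, ← ofReal_cpow_two_mul (by positivity), ofReal_div_cpow Real.pi_pos ha,
    inv_div]

theorem two_cpow_ne_zero (s : ℂ) : (2 : ℂ) ^ s ≠ 0 := by
  simp [Complex.cpow_eq_zero_iff]

theorem tsum_trianglePair_eq_latticeG (ha : 0 < a) (hs : 1 < s.re) :
    (((Real.pi / a) ^ 2 : ℝ) : ℂ) ^ (-s) * ∑' p : TrianglePair, sumSqTerm s (p.1.1, p.1.2) =
      (a : ℂ) ^ (2 * s) / 2 *
        (1 / 4 * latticeG s - 1 / (Real.pi : ℂ) ^ (2 * s) * riemannZeta (2 * s)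
          - 1 / ((2 * Real.pi ^ 2 : ℝ) : ℂ) ^ s * riemannZeta (2 * s)) := by
  have hE := two_cpow_ne_zero s
  have hP := ofReal_cpow_ne_zero Real.pi_pos (2 * s)
  have h2 : ((2 * Real.pi ^ 2 : ℝ) : ℂ) ^ s = (2 : ℂ) ^ s * (Real.pi : ℂ) ^ (2 * s) := by
    rw [ofReal_cpow_two_mul Real.pi_pos, Complex.ofReal_mul,
      Complex.mul_cpow_ofReal_nonneg zero_le_two (by positivity), Complex.ofReal_ofNat]
  rw [eigenvalue_scale_cpow ha, latticeG_eq hs, quadrantSum_eq hs, h2, Complex.cpow_neg]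
  field_simp
  ring

/-- Of the two terms with `ζ(2s)`, the coefficient `-1/4` is half of the `-1/2` left by Jacobi
inversion, and `-1/2^(s+1)` is half of the diagonal `2^(-s)`. Division by `Γ(s)` is harmless because
`Re s > 1`. -/
theorem tsum_trianglePair_eq_chowlaSelbergExpr (ha : 0 < a) (hs : 1 < s.re) :
    (((Real.pi / a) ^ 2 : ℝ) : ℂ) ^ (-s) * ∑' p : TrianglePair, sumSqTerm s (p.1.1, p.1.2) =
      chowlaSelbergExpr a s := by
  have hπ := Real.pi_pos
  have hE := two_cpow_ne_zero s
  have hp := ofReal_cpow_ne_zero hπ s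
  have hΓ : Complex.Gamma s ≠ 0 := Complex.Gamma_ne_zero_of_re_pos (by linarith)
  have hP : (Real.pi : ℂ) ^ (2 * s) = (Real.pi : ℂ) ^ s * (Real.pi : ℂ) ^ s := by
    rw [two_mul, Complex.cpow_add _ _ (Complex.ofReal_ne_zero.2 hπ.ne')]
  have hhalf : (Real.pi : ℂ) ^ (-(s - 1 / 2)) =
      ((Real.pi : ℂ) ^ s)⁻¹ * (Real.sqrt Real.pi : ℂ) := by
    rw [neg_sub, sub_eq_neg_add, Complex.cpow_add _ _ (Complex.ofReal_ne_zero.2 hπ.ne'),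
      Complex.cpow_neg, Real.sqrt_eq_rpow, Complex.ofReal_cpow hπ.le]
    norm_num
  have hE1 : (2 : ℂ) ^ (s + 1) = (2 : ℂ) ^ s * 2 := by
    rw [Complex.cpow_add _ _ two_ne_zero, Complex.cpow_one]
  have hmain := Gamma_mul_quadrantSum hs
  rw [hhalf, quadrantSum_eq hs, Complex.cpow_neg, Complex.cpow_neg] at hmain
  rw [chowlaSelbergExpr, eigenvalue_scale_cpow ha, ofReal_div_cpow ha hπ,
    ofReal_div_cpow (by positivity) hπ, ← ofReal_cpow_two_mul ha, hP, hE1]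
  generalize ∑' p : TrianglePair, sumSqTerm s (p.1.1, p.1.2) = T at *
  generalize ∑' n : ℕ+, divisorTerm s n = S at *
  generalize (Real.pi : ℂ) ^ s = p at *
  generalize (2 : ℂ) ^ s = E at *
  generalize Complex.Gamma s = Γ at *
  generalize (a : ℂ) ^ (2 * s) = A
  field_simp at hmain ⊢
  linear_combination 2 * A * hmain

end Assembly

/-! ### The main theorem. -/

theorem mainTheorem8 (a : ℝ) (ha : 0 < a) (Ω : Set Plane) (hΩ : IsIsoscelesRightTriangle a Ω) :
    (∀ lam : ℝ, FiniteDimensional ℝ (dirichletEigenspace Ω lam)) ∧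
    (∀ lam ∈ dirichletSpectrum Ω, 0 < lam) ∧
    (∀ s : ℂ, 1 < s.re →
      Summable (spectralZetaTerm Ω s) ∧
      Summable (fun p : {p : ℤ × ℤ // p ≠ 0} => latticeTerm s p) ∧
      dirichletSpectralZeta Ω s = chowlaSelbergExpr a s ∧
      dirichletSpectralZeta Ω s =
        (a : ℂ) ^ (2 * s) / 2 *
          (1 / 4 * latticeG s - 1 / (Real.pi : ℂ) ^ (2 * s) * riemannZeta (2 * s)
            - 1 / ((2 * Real.pi ^ 2 : ℝ) : ℂ) ^ s * riemannZeta (2 * s))) ∧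
    (∀ s : ℂ, (∀ n : ℕ+, IntegrableOn (besselIntegrand s n) (Ioi 0)) ∧
      Summable (divisorTerm s)) ∧
    MeromorphicOn (chowlaSelbergExpr a) univ := by
  obtain ⟨v, w, c, d, h⟩ := hΩ.exists_chart ha
  refine ⟨h.finiteDimensional_dirichletEigenspace, fun lam hl => h.pos_of_mem_dirichletSpectrum hl,
    fun s hs => ?_, fun s => ⟨integrableOn_besselIntegrand s, summable_divisorTerm s⟩,
    meromorphicOn_chowlaSelbergExpr ha⟩
  have hsum := h.hasSum_spectralZetaTerm hs
  refine ⟨hsum.summable, summable_latticeTerm hs, ?_, ?_⟩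
  · rw [dirichletSpectralZeta, hsum.tsum_eq, tsum_trianglePair_eq_chowlaSelbergExpr ha hs]
  · rw [dirichletSpectralZeta, hsum.tsum_eq, tsum_trianglePair_eq_latticeG ha hs]
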